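/- For a real matrix $B$ with $m\ge 1$ rows and $k\ge 0$ columns and a vector $x\in\mathbb{R}^k$ let $\mathrm{disc}_2(B,x)=\frac{1}{\sqrt m}\|Bx\|_2$, let $\mathrm{disc}_2(B)=\min_{x\in\{-1,+1\}^k}\mathrm{disc}_2(B,x)$, and let $\mathrm{herdisc}_2(A)=\max_B \mathrm{disc}_2(B)$, where $B$ ranges over all matrices obtained from $A$ by removing a (possibly empty) subset of the columns. Theorem. There is a deterministic algorithm which, given any $m\times n$ real matrix $A$ with $m,n\ge 1$, runs in $O((m+n)n^2)$ time and outputs a coloring $x\in\{-1,+1\}^n$ that, for $n\ge 2$, satisfies $$\mathrm{disc}_2(A,x)=O\bigl(\sqrt{\lg n}\cdot \mathrm{herdisc}_2(A)\bigr).$$ That is, there are a single program $P$ and absolute constants $c,K$ such that for all $m,n\ge 1$ and every $A\in\mathbb{R}^{m\times n}$, the program $P$ on input $(m,n,A)$ halts after at most $c\,(m+n)n^2$ steps with an output $x\in\{-1,+1\}^n$, and, if $n\ge 2$, $\frac{1}{\sqrt m}\|Ax\|_2\le K\sqrt{\lg n}\cdot\mathrm{herdisc}_2(A)$. Here $\lg=\log_2$,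 and time is measured in the real RAM model: the machine stores natural-number indices (which can be added, subtracted and compared) and arrays of exact real numbers addressed by such indices, has integer constants, and performs each memory access, arithmetic operation $+,-,\times,/$, square root, or comparison of real numbers in one step. -/

import Mathlib

/-! ### Discrepancy -/

/-- The colorings `{-1, +1}^ι`. -/
def colorings (ι : Type) : Set (ι → ℝ) :=
  {x | ∀ i, x i = -1 ∨ x i = 1}

/-- The `ℓ₂`-discrepancy `‖A x‖₂ / √m` of a vector `x` with respect to an `m`-row matrix `A`. -/
noncomputable def discTwoOf {m : ℕ} {ι : Type} [Fintype ι] (A : Matrix (Fin m) ι ℝ)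
    (x : ι → ℝ) : ℝ :=
  ‖WithLp.toLp 2 (A.mulVec x)‖ / √(m : ℝ)

/-- The `ℓ₂`-discrepancy of a matrix: the minimum over all colorings (a finite nonempty set). -/
noncomputable def discTwo {m : ℕ} {ι : Type} [Fintype ι] (A : Matrix (Fin m) ι ℝ) : ℝ :=
  ⨅ x : colorings ι, discTwoOf A x.1

/-- The hereditary `ℓ₂`-discrepancy: the maximum of the `ℓ₂`-discrepancy over all matrices that
are obtained by keeping a subset `J` of the columns. -/
noncomputable def herdiscTwo {m n : ℕ} (A : Matrix (Fin m) (Fin n) ℝ) : ℝ :=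
  ⨆ J : Finset (Fin n), discTwo (A.submatrix id (fun j : J => (j : Fin n)))

/-! ### A real RAM with unit costs

The machine has index registers, which hold natural numbers, and two-dimensional arrays, whose
cells hold real numbers. The registers and arrays that a program uses are named by numerals in its
text, so each program uses finitely many of them; array cells are addressed by computed indices.
Indices can be added, subtracted and compared. Reals can be added, subtracted, multiplied, divided,
compared, and one can take square roots; the only constants are integers. There is no way to turn
a real number into an index. Each operation, memory access, test and constant costs one step. -/

namespace RealRAM

/-- Memory contents: index registers and two-dimensional real arrays. -/
structure State where
  idx : ℕ → ℕ
  arr : ℕ → ℕ → ℕ → ℝ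

/-- Index expressions. -/
inductive IdxExpr where
  | const (c : ℕ)
  | reg (r : ℕ)
  | add (e f : IdxExpr)
  | sub (e f : IdxExpr)

/-- The value of an index expression; subtraction is truncated at `0`. -/
def IdxExpr.eval (s : State) : IdxExpr → ℕ
  | .const c => c
  | .reg r => s.idx r
  | .add e f => e.eval s + f.eval s
  | .sub e f => e.eval s - f.eval s

/-- The number of operations and accesses in an index expression. -/
def IdxExpr.cost : IdxExpr → ℕ
  | .const _ => 1
  | .reg _ => 1
  | .add e f => e.cost + f.cost + 1
  | .sub e f => e.cost + f.cost + 1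

/-- Real expressions; `cell a i j` is the entry `(i, j)` of the array `a`. -/
inductive RealExpr where
  | const (c : ℤ)
  | cell (a : ℕ) (i j : IdxExpr)
  | add (e f : RealExpr)
  | sub (e f : RealExpr)
  | mul (e f : RealExpr)
  | div (e f : RealExpr)
  | sqrt (e : RealExpr)

/-- The value of a real expression; a division by `0` and the square root of a negative number
give `0`. -/
noncomputable def RealExpr.eval (s : State) : RealExpr → ℝ
  | .const c => (c : ℝ)
  | .cell a i j => s.arr a (i.eval s) (j.eval s)
  | .add e f => e.eval s + f.eval s
  | .sub e f => e.eval s - f.eval s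
  | .mul e f => e.eval s * f.eval s
  | .div e f => e.eval s / f.eval s
  | .sqrt e => √(e.eval s)

/-- The number of operations and accesses in a real expression. -/
def RealExpr.cost : RealExpr → ℕ
  | .const _ => 1
  | .cell _ i j => i.cost + j.cost + 1
  | .add e f => e.cost + f.cost + 1
  | .sub e f => e.cost + f.cost + 1
  | .mul e f => e.cost + f.cost + 1
  | .div e f => e.cost + f.cost + 1
  | .sqrt e => e.cost + 1

/-- Tests: comparisons of indices, comparisons of reals, and their Boolean combinations. -/
inductive Test where
  | idxLt (e f : IdxExpr)
  | realLt (e f : RealExpr)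
  | not (b : Test)
  | and (b d : Test)

/-- Whether a test succeeds. -/
def Test.Holds (s : State) : Test → Prop
  | .idxLt e f => e.eval s < f.eval s
  | .realLt e f => e.eval s < f.eval s
  | .not b => ¬ b.Holds s
  | .and b d => b.Holds s ∧ d.Holds s

/-- The number of operations and accesses in a test. -/
def Test.cost : Test → ℕ
  | .idxLt e f => e.cost + f.cost + 1
  | .realLt e f => e.cost + f.cost + 1
  | .not b => b.cost + 1
  | .and b d => b.cost + d.cost + 1

/-- Programs. -/
inductive Prog where
  | skip
  | setIdx (r : ℕ) (e : IdxExpr)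
  | setCell (a : ℕ) (i j : IdxExpr) (e : RealExpr)
  | seq (p q : Prog)
  | branch (b : Test) (p q : Prog)
  | loop (b : Test) (p : Prog)

/-- Write the value `v` to the index register `r`. -/
def State.writeIdx (s : State) (r v : ℕ) : State :=
  ⟨Function.update s.idx r v, s.arr⟩

/-- Write the value `v` to the entry `(i, j)` of the array `a`. -/
def State.writeCell (s : State) (a i j : ℕ) (v : ℝ) : State :=
  ⟨s.idx, Function.update s.arr a
    (Function.update (s.arr a) i (Function.update (s.arr a i) j v))⟩

/-- `Run p s t s'`: started in the state `s`, the program `p` halts after exactly `t` steps in the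
state `s'`. -/
inductive Run : Prog → State → ℕ → State → Prop where
  | skip (s : State) : Run .skip s 1 s
  | setIdx (s : State) (r : ℕ) (e : IdxExpr) :
      Run (.setIdx r e) s (e.cost + 1) (s.writeIdx r (e.eval s))
  | setCell (s : State) (a : ℕ) (i j : IdxExpr) (e : RealExpr) :
      Run (.setCell a i j e) s (i.cost + j.cost + e.cost + 1)
        (s.writeCell a (i.eval s) (j.eval s) (e.eval s))
  | seq {p q : Prog} {s s₁ s₂ : State} {t₁ t₂ : ℕ} :
      Run p s t₁ s₁ → Run q s₁ t₂ s₂ → Run (.seq p q) s (t₁ + t₂) s₂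
  | branchTrue {b : Test} {p q : Prog} {s s₁ : State} {t : ℕ} :
      b.Holds s → Run p s t s₁ → Run (.branch b p q) s (b.cost + t + 1) s₁
  | branchFalse {b : Test} {p q : Prog} {s s₁ : State} {t : ℕ} :
      ¬ b.Holds s → Run q s t s₁ → Run (.branch b p q) s (b.cost + t + 1) s₁
  | loopTrue {b : Test} {p : Prog} {s s₁ s₂ : State} {t₁ t₂ : ℕ} :
      b.Holds s → Run p s t₁ s₁ → Run (.loop b p) s₁ t₂ s₂ →
        Run (.loop b p) s (b.cost + t₁ + t₂ + 1) s₂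
  | loopFalse {b : Test} {p : Prog} {s : State} :
      ¬ b.Holds s → Run (.loop b p) s (b.cost + 1) s

/-- The machine is deterministic: step count and final state are determined by the program and the
initial state. -/
theorem Run.deterministic {p : Prog} {s s₁ s₂ : State} {t₁ t₂ : ℕ}
    (h₁ : Run p s t₁ s₁) (h₂ : Run p s t₂ s₂) : t₁ = t₂ ∧ s₁ = s₂ := by
  induction h₁ generalizing t₂ s₂ with
  | skip s => cases h₂; exact ⟨rfl, rfl⟩
  | setIdx s r e => cases h₂; exact ⟨rfl, rfl⟩
  | setCell s a i j e => cases h₂; exact ⟨rfl, rfl⟩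
  | seq _ _ ih₁ ih₂ =>
    cases h₂ with
    | seq k₁ k₂ =>
      obtain ⟨rfl, rfl⟩ := ih₁ k₁
      obtain ⟨rfl, rfl⟩ := ih₂ k₂
      exact ⟨rfl, rfl⟩
  | branchTrue hb _ ih =>
    cases h₂ with
    | branchTrue _ k => obtain ⟨rfl, rfl⟩ := ih k; exact ⟨rfl, rfl⟩
    | branchFalse hn _ => exact absurd hb hn
  | branchFalse hb _ ih =>
    cases h₂ with
    | branchTrue hn _ => exact absurd hn hb
    | branchFalse _ k => obtain ⟨rfl, rfl⟩ := ih k; exact ⟨rfl, rfl⟩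
  | loopTrue hb _ _ ih₁ ih₂ =>
    cases h₂ with
    | loopTrue _ k₁ k₂ =>
      obtain ⟨rfl, rfl⟩ := ih₁ k₁
      obtain ⟨rfl, rfl⟩ := ih₂ k₂
      exact ⟨rfl, rfl⟩
    | loopFalse hn => exact absurd hb hn
  | loopFalse hb =>
    cases h₂ with
    | loopTrue hn _ _ => exact absurd hn hb
    | loopFalse _ => exact ⟨rfl, rfl⟩

/-- The initial state for an `m × n` input matrix: registers `0` and `1` hold `m` and `n`, array
`0` holds the matrix, and everything else is `0`. -/
def input {m n : ℕ} (A : Matrix (Fin m) (Fin n) ℝ) : State where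
  idx r := if r = 0 then m else if r = 1 then n else 0
  arr a i j := if h : a = 0 ∧ i < m ∧ j < n then A ⟨i, h.2.1⟩ ⟨j, h.2.2⟩ else 0

/-- The output vector of length `n`: the first `n` entries of row `0` of array `1`. -/
def output (n : ℕ) (s : State) : Fin n → ℝ :=
  fun j => s.arr 1 0 j

end RealRAM

/-! The algorithm is a deterministic walk from the zero coloring that fixes one coordinate at `±1`
per step. Let `S` be the set of coordinates not yet fixed and `H` the inverse of `Q = ε I + Aᵀ A`
restricted to `S`. A step takes the index `q` maximizing `H q q` and moves along `± H e_q` until a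
coordinate reaches `±1`.

With `y = H e_q` one has `‖A y‖² ≤ yᵀ Q y = H q q`, while `‖y‖² ≥ (H q q)²`. So for `η = H q q` the
second-order change of `η ‖A x‖² - ∑_{i ∈ S} x_i²` is nonpositive, and the sign of the direction is
chosen to make the first-order change nonpositive too. Removing the fixed coordinate from `S` costs
`1`, which is paid for by enlarging an error allowance by `128 V / |S|`. At the end the allowance is
a harmonic sum, whence the factor `lg n` for the squared norm (`WalkInv.step`, `WalkInv.final`).

The payment suffices because `|S| ≤ 128 η V`, where `V` bounds the squared discrepancy of every set
of columns (`IsInvOn.card_le`). This is a counting argument: each of the `3^k` ternary combinations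
of the columns can be rounded to one of `2^k` signed sums with small error, by coloring the zero
coordinates. The columns of `H` give short dual vectors to the (regularized) columns of `A`, so only
few ternary combinations lie near a given point, measured by a Gaussian sum of at most `(9/8)^k`
(`card_le_of_rounding`). Since `3 > 2 · 9/8`, this bounds `k`.

The regularization `ε = ‖A‖_F² / n²` makes `Q` invertible and satisfies `ε n ≤ V`. Building `H`
takes `m` Sherman–Morrison updates, removing an index is another rank-one update, and each of the
`n` steps costs `O(mn + n²)`. -/

/-! ### An exponential sum over ternary combinations -/

/-- The three values `-1`, `0`, `1`. -/
noncomputable def ternary (i : Fin 3) : ℝ := (i : ℝ) - 1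

theorem exp_neg_four_le : Real.exp (-4) ≤ 1 / 16 := by
  have h := Real.add_one_le_exp (1 : ℝ)
  have h4 : Real.exp 4 = Real.exp 1 ^ 4 := by
    rw [← Real.exp_nat_mul]; norm_num
  rw [Real.exp_neg, h4, inv_eq_one_div]
  apply one_div_le_one_div_of_le (by norm_num)
  calc (16 : ℝ) = 2 ^ 4 := by norm_num
    _ ≤ Real.exp 1 ^ 4 := by gcongr; linarith

theorem exp_neg_sixteen_mul_sq_le {r : ℝ} (h : 1 / 4 ≤ r ^ 2) :
    Real.exp (-(16 * r ^ 2)) ≤ 1 / 16 :=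
  le_trans (Real.exp_le_exp.2 (by linarith)) exp_neg_four_le

theorem exp_neg_sixteen_mul_sq_le_one (r : ℝ) : Real.exp (-(16 * r ^ 2)) ≤ 1 :=
  Real.exp_le_one_iff.2 (by nlinarith [sq_nonneg r])

/-- At least two of `s - 1`, `s`, `s + 1` have absolute value at least `1/2`; each of these
contributes at most `exp (-4) ≤ 1/16`, and the third at most `1`. -/
theorem sum_exp_ternary_le (s : ℝ) :
    ∑ i : Fin 3, Real.exp (-(16 * (s + ternary i) ^ 2)) ≤ 9 / 8 := by
  have e0 : ternary 0 = -1 := by norm_num [ternary]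
  have e1 : ternary 1 = 0 := by norm_num [ternary]
  have e2 : ternary 2 = 1 := by norm_num [ternary]
  rw [Fin.sum_univ_three, e0, e1, e2]
  rcases le_total s (-(1 / 2)) with h | h
  · have h0 := exp_neg_sixteen_mul_sq_le (r := s + -1) (by nlinarith)
    have h1 := exp_neg_sixteen_mul_sq_le (r := s + 0) (by nlinarith)
    have h2 := exp_neg_sixteen_mul_sq_le_one (s + 1)
    linarith
  rcases le_total s (1 / 2) with h' | h'
  · have h0 := exp_neg_sixteen_mul_sq_le (r := s + -1) (by nlinarith)
    have h1 := exp_neg_sixteen_mul_sq_le_one (s + 0)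
    have h2 := exp_neg_sixteen_mul_sq_le (r := s + 1) (by nlinarith)
    linarith
  · have h0 := exp_neg_sixteen_mul_sq_le_one (s + -1)
    have h1 := exp_neg_sixteen_mul_sq_le (r := s + 0) (by nlinarith)
    have h2 := exp_neg_sixteen_mul_sq_le (r := s + 1) (by nlinarith)
    linarith

section ExpSum

variable {E : Type*} [NormedAddCommGroup E] [InnerProductSpace ℝ E]

theorem norm_sq_eq_add_norm_sq_sub_proj (v u : E) (hu : u ≠ 0) :
    ‖v‖ ^ 2 = inner ℝ v u ^ 2 / ‖u‖ ^ 2 + ‖v - (inner ℝ v u / ‖u‖ ^ 2) • u‖ ^ 2 := by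
  have hn : ‖u‖ ^ 2 ≠ 0 := by positivity
  rw [norm_sub_sq_real, inner_smul_right, norm_smul, mul_pow, Real.norm_eq_abs, sq_abs]
  field_simp
  ring

/-- If the vectors `a i` have a dual family of short vectors, then few of the translates of their
ternary combinations are short. -/
theorem sum_exp_neg_norm_sq_le {θ : ℝ} (hθ : 0 ≤ θ) (k : ℕ) (a u : Fin k → E)
    (hdual : ∀ i j, inner ℝ (a i) (u j) = if i = j then (1 : ℝ) else 0)
    (hu : ∀ j, 16 * ‖u j‖ ^ 2 ≤ θ) (b : E) :
    ∑ w : Fin k → Fin 3, Real.exp (-(θ * ‖b + ∑ i, ternary (w i) • a i‖ ^ 2)) ≤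
      (9 / 8 : ℝ) ^ k := by
  induction k generalizing b with
  | zero =>
    simpa using mul_nonneg hθ (sq_nonneg ‖b‖)
  | succ k ih =>
    have hu0 : u 0 ≠ 0 := by
      intro h
      have := hdual 0 0
      simp [h] at this
    have hn : 0 < ‖u 0‖ ^ 2 := by positivity
    set s : ℝ := inner ℝ b (u 0) with hs
    -- The vectors `a i.succ` are orthogonal to `u 0`, so projecting `u 0` away only moves the base
    -- point, and the remaining dual family can be used unchanged in the induction.
    let b' : Fin 3 → E := fun z =>
      b + ternary z • a 0 - ((s + ternary z) / ‖u 0‖ ^ 2) • u 0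
    have hperp : ∀ w : Fin k → Fin 3,
        inner ℝ (∑ i : Fin k, ternary (w i) • a i.succ) (u 0) = (0 : ℝ) := by
      intro w
      simp [sum_inner, inner_smul_left, hdual, Fin.succ_ne_zero]
    have hsplit : ∀ (z : Fin 3) (w : Fin k → Fin 3),
        16 * (s + ternary z) ^ 2 + θ * ‖b' z + ∑ i : Fin k, ternary (w i) • a i.succ‖ ^ 2 ≤
          θ * ‖b + (ternary z • a 0 + ∑ i : Fin k, ternary (w i) • a i.succ)‖ ^ 2 := by
      intro z w
      have hin : inner ℝ (b + (ternary z • a 0 + ∑ i : Fin k, ternary (w i) • a i.succ)) (u 0)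
          = s + ternary z := by
        rw [inner_add_left, inner_add_left, hperp, inner_smul_left, hdual]
        simp [hs]
      rw [norm_sq_eq_add_norm_sq_sub_proj
        (b + (ternary z • a 0 + ∑ i : Fin k, ternary (w i) • a i.succ)) (u 0) hu0, hin, mul_add]
      have e : b + (ternary z • a 0 + ∑ i : Fin k, ternary (w i) • a i.succ) -
          ((s + ternary z) / ‖u 0‖ ^ 2) • u 0 =
          b' z + ∑ i : Fin k, ternary (w i) • a i.succ := by
        simp only [b']; abel
      rw [e]
      have : 16 * (s + ternary z) ^ 2 ≤ θ * ((s + ternary z) ^ 2 / ‖u 0‖ ^ 2) := by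
        rw [← mul_div_assoc, le_div_iff₀ hn]
        nlinarith [mul_le_mul_of_nonneg_right (hu 0) (sq_nonneg (s + ternary z))]
      linarith
    rw [← (Fin.consEquiv fun _ => Fin 3).sum_comp, Fintype.sum_prod_type]
    calc _ ≤ ∑ z : Fin 3, ∑ w : Fin k → Fin 3, Real.exp (-(16 * (s + ternary z) ^ 2)) *
          Real.exp (-(θ * ‖b' z + ∑ i : Fin k, ternary (w i) • a i.succ‖ ^ 2)) := by
          gcongr with z _ w _
          rw [← Real.exp_add]
          apply Real.exp_le_exp.2
          have := hsplit z w
          simp only [Fin.consEquiv_apply, Fin.sum_univ_succ, Fin.cons_zero, Fin.cons_succ]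
          linarith
      _ ≤ ∑ z : Fin 3, Real.exp (-(16 * (s + ternary z) ^ 2)) * (9 / 8 : ℝ) ^ k := by
          gcongr with z _
          rw [← Finset.mul_sum]
          gcongr
          exact ih (fun i => a i.succ) (fun i => u i.succ)
            (fun i j => by simp [hdual, Fin.succ_inj]) (fun j => hu _) _
      _ ≤ (9 / 8 : ℝ) ^ (k + 1) := by
          rw [← Finset.sum_mul, pow_succ, mul_comm]
          gcongr
          exact sum_exp_ternary_le s

/-- A family with a dual family of vectors of squared norm at most `η`, all of whose ternary
combinations can be rounded to signed sums with squared error at most `V`, has at most `64 η V`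
members. -/
theorem card_le_of_rounding {η V : ℝ} (k : ℕ) (a u : Fin k → E) (hη : 0 ≤ η)
    (hdual : ∀ i j, inner ℝ (a i) (u j) = if i = j then (1 : ℝ) else 0)
    (hu : ∀ j, ‖u j‖ ^ 2 ≤ η)
    (hround : ∀ w : Fin k → Fin 3, ∃ x : Fin k → Bool,
      ‖∑ i, (ternary (w i) - if x i then 1 else -1) • a i‖ ^ 2 ≤ V) :
    (k : ℝ) ≤ 64 * η * V := by
  choose f hf using hround
  let F : (Fin k → Fin 3) → (Fin k → Bool) → ℝ := fun w x =>
    Real.exp (-(16 * η * ‖∑ i, (ternary (w i) - if x i then 1 else -1) • a i‖ ^ 2))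
  have h1 : (3 : ℝ) ^ k * Real.exp (-(16 * η * V)) ≤ ∑ w, F w (f w) := by
    have : (3 : ℝ) ^ k * Real.exp (-(16 * η * V)) =
        ∑ _w : Fin k → Fin 3, Real.exp (-(16 * η * V)) := by simp
    rw [this]
    gcongr with w _
    apply Real.exp_le_exp.2
    have := mul_le_mul_of_nonneg_left (hf w) (show 0 ≤ 16 * η by positivity)
    linarith
  have h2 : ∑ w, F w (f w) ≤ ∑ x, ∑ w, F w x := by
    rw [Finset.sum_comm]
    gcongr with w _
    exact Finset.single_le_sum (f := fun x => F w x) (fun x _ => (Real.exp_pos _).le)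
      (Finset.mem_univ _)
  have h3 : ∑ x, ∑ w, F w x ≤ (2 : ℝ) ^ k * (9 / 8 : ℝ) ^ k := by
    have : (2 : ℝ) ^ k * (9 / 8 : ℝ) ^ k = ∑ _x : Fin k → Bool, (9 / 8 : ℝ) ^ k := by simp
    rw [this]
    gcongr with x _
    -- A fixed coloring only supplies a translation of the ternary combinations.
    have := sum_exp_neg_norm_sq_le (θ := 16 * η) (by positivity) k a u hdual
      (fun j => by linarith [hu j]) (-∑ i, (if x i then (1 : ℝ) else -1) • a i)
    refine le_trans (le_of_eq ?_) this
    refine Finset.sum_congr rfl fun w _ => ?_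
    simp only [F, sub_smul, Finset.sum_sub_distrib]
    rw [neg_add_eq_sub]
  have h4 : (3 : ℝ) ^ k * Real.exp (-(16 * η * V)) ≤ (9 / 4 : ℝ) ^ k := by
    refine (h1.trans (h2.trans h3)).trans (le_of_eq ?_)
    rw [← mul_pow]; norm_num
  -- The ratio `4/3` is `3 / (9/4)`; its fourth power `256/81` exceeds `e`. Hence `k / 4 ≤ 16 η V`,
  -- which is where `64` comes from.
  have h5 : Real.exp (1 / 4) ≤ 4 / 3 := by
    have e : Real.exp 1 = Real.exp (1 / 4) ^ 4 := by
      rw [← Real.exp_nat_mul]; norm_num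
    have := Real.exp_one_lt_d9
    by_contra! hc
    have : (4 / 3 : ℝ) ^ 4 < Real.exp (1 / 4) ^ 4 := by gcongr
    rw [← e] at this
    norm_num at this
    linarith
  have h6 : Real.exp (k / 4 : ℝ) ≤ Real.exp (16 * η * V) := by
    have e : Real.exp (k / 4 : ℝ) = Real.exp (1 / 4) ^ k := by
      rw [← Real.exp_nat_mul]; ring_nf
    rw [e]
    calc Real.exp (1 / 4) ^ k ≤ (4 / 3 : ℝ) ^ k := by gcongr
      _ = (3 : ℝ) ^ k / (9 / 4 : ℝ) ^ k := by rw [← div_pow]; norm_num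
      _ ≤ Real.exp (16 * η * V) := by
        rw [div_le_iff₀ (by positivity), mul_comm]
        rwa [Real.exp_neg, ← div_eq_mul_inv, div_le_iff₀ (Real.exp_pos _)] at h4
  have := Real.exp_le_exp.1 h6
  linarith

end ExpSum

/-! ### Regularized Gram matrices and their inverses

Matrices are functions on pairs of natural numbers, of which only the entries with indices below
the dimensions matter. -/

open Finset

/-- The matrix `ε I + ∑_{t < r} aₜ aₜᵀ`, where `aₜ` are the rows of `A`. -/
noncomputable def regGram (A : ℕ → ℕ → ℝ) (ε : ℝ) (r i j : ℕ) : ℝ :=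
  (if i = j then ε else 0) + ∑ t ∈ range r, A t i * A t j

theorem sum_regGram_mul (A : ℕ → ℕ → ℝ) (ε : ℝ) (r : ℕ) (S : Finset ℕ) {i : ℕ} (hi : i ∈ S)
    (y : ℕ → ℝ) :
    ∑ l ∈ S, regGram A ε r i l * y l =
      ε * y i + ∑ t ∈ range r, A t i * ∑ l ∈ S, A t l * y l := by
  simp only [regGram, add_mul, sum_add_distrib, ite_mul, zero_mul, sum_ite_eq, hi, if_true]
  congr 1
  simp only [sum_mul, mul_sum]
  rw [sum_comm]
  exact sum_congr rfl fun t _ => sum_congr rfl fun l _ => by ring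

theorem sum_sum_regGram_mul (A : ℕ → ℕ → ℝ) (ε : ℝ) (r : ℕ) (S : Finset ℕ) (x y : ℕ → ℝ) :
    ∑ i ∈ S, x i * ∑ l ∈ S, regGram A ε r i l * y l =
      ε * ∑ i ∈ S, x i * y i +
        ∑ t ∈ range r, (∑ l ∈ S, A t l * x l) * ∑ l ∈ S, A t l * y l := by
  rw [sum_congr rfl fun i hi => by rw [sum_regGram_mul A ε r S hi y, mul_add], sum_add_distrib]
  congr 1
  · rw [mul_sum]; exact sum_congr rfl fun t _ => by ring
  · simp only [mul_sum (s := range r), sum_mul]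
    rw [sum_comm]
    exact sum_congr rfl fun t _ => sum_congr rfl fun l _ => by ring

/-- On the index set `S ⊆ {0, …, n - 1}` the symmetric matrix `H` is the inverse of `Q`, and it
vanishes outside of `S`. -/
structure IsInvOn (n : ℕ) (S : Finset ℕ) (Q H : ℕ → ℕ → ℝ) : Prop where
  subset : S ⊆ range n
  symm : ∀ i < n, ∀ j < n, H i j = H j i
  off : ∀ i < n, i ∉ S → ∀ j < n, H i j = 0
  inv : ∀ i ∈ S, ∀ j ∈ S, ∑ l ∈ S, Q i l * H l j = if i = j then 1 else 0

namespace IsInvOn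

variable {n m : ℕ} {S : Finset ℕ} {A H : ℕ → ℕ → ℝ} {ε : ℝ}

theorem lt {Q : ℕ → ℕ → ℝ} (h : IsInvOn n S Q H) {i : ℕ} (hi : i ∈ S) : i < n :=
  mem_range.1 (h.subset hi)

theorem sum_mul_col {Q : ℕ → ℕ → ℝ} (h : IsInvOn n S Q H) {j : ℕ} (hj : j ∈ S) (y : ℕ → ℝ) :
    ∑ l ∈ range n, y l * H l j = ∑ l ∈ S, y l * H l j := by
  symm
  apply sum_subset h.subset
  intro i hi hiS
  rw [h.off i (mem_range.1 hi) hiS j (h.lt hj), mul_zero]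

/-- The column `j` of `H` represents the `j`-th coordinate. -/
theorem repr (h : IsInvOn n S (regGram A ε m) H) {j : ℕ} (hj : j ∈ S) (y : ℕ → ℝ) :
    ε * ∑ i ∈ S, y i * H i j +
      ∑ t ∈ range m, (∑ l ∈ S, A t l * y l) * ∑ l ∈ S, A t l * H l j = y j := by
  rw [← sum_sum_regGram_mul A ε m S y (fun l => H l j)]
  rw [sum_congr rfl fun i hi => by rw [h.inv i hi j hj]]
  simp [hj]

/-- This is `repr` for `y = H e_j`. It is the source of both `‖A H e_j‖² ≤ H j j` and the norm of
the dual vectors. -/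
theorem repr_diag (h : IsInvOn n S (regGram A ε m) H) {j : ℕ} (hj : j ∈ S) :
    ε * ∑ i ∈ S, H i j ^ 2 + ∑ t ∈ range m, (∑ l ∈ S, A t l * H l j) ^ 2 = H j j := by
  simpa [sq] using h.repr hj (fun i => H i j)

theorem diag_nonneg (h : IsInvOn n S (regGram A ε m) H) (hε : 0 ≤ ε) {j : ℕ} (hj : j < n) :
    0 ≤ H j j := by
  by_cases hS : j ∈ S
  · rw [← h.repr_diag hS]; positivity
  · rw [h.off j hj hS j hj]

/-- If `H j j = 0`, then `A H e_j = 0` by `repr_diag`, and `repr` for the unit vector `e_j` reads `0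
= 1`. -/
theorem diag_pos (h : IsInvOn n S (regGram A ε m) H) (hε : 0 < ε) {j : ℕ} (hj : j ∈ S) :
    0 < H j j := by
  refine lt_of_le_of_ne (h.diag_nonneg hε.le (h.lt hj)) fun h0 => ?_
  have h1 := h.repr_diag hj
  rw [← h0] at h1
  have h2 : 0 ≤ ε * ∑ i ∈ S, H i j ^ 2 := by positivity
  have h3 : 0 ≤ ∑ t ∈ range m, (∑ l ∈ S, A t l * H l j) ^ 2 := by positivity
  have h4 : ∑ t ∈ range m, (∑ l ∈ S, A t l * H l j) ^ 2 = 0 := by linarith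
  rw [sum_eq_zero_iff_of_nonneg (fun _ _ => sq_nonneg _)] at h4
  have h5 := h.repr hj (fun i => if i = j then 1 else 0)
  rw [sum_eq_zero (s := range m) (fun t ht => by
    rw [pow_eq_zero_iff two_ne_zero |>.1 (h4 t ht), mul_zero])] at h5
  simp [hj, ← h0] at h5

/-- Removing an index from the support. -/
theorem erase {Q H' : ℕ → ℕ → ℝ} (h : IsInvOn n S Q H) {p : ℕ} (hp : p ∈ S) (hpp : H p p ≠ 0)
    (hH' : ∀ i < n, ∀ j < n, H' i j = H i j - H i p * H j p / H p p) :
    IsInvOn n (S.erase p) Q H' where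
  subset := (erase_subset _ _).trans h.subset
  symm i hi j hj := by rw [hH' i hi j hj, hH' j hj i hi, h.symm i hi j hj]; ring
  off i hi hiS j hj := by
    rw [hH' i hi j hj]
    by_cases hip : i = p
    · subst hip
      rw [h.symm j hj i hi]; field_simp; ring
    · have : i ∉ S := fun hc => hiS (mem_erase.2 ⟨hip, hc⟩)
      rw [h.off i hi this j hj, h.off i hi this p (h.lt hp)]; simp
  inv i hi j hj := by
    obtain ⟨hip, hiS⟩ := mem_erase.1 hi
    obtain ⟨hjp, hjS⟩ := mem_erase.1 hj
    have hjn := h.lt hjS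
    have hpn := h.lt hp
    have e0 : H' p j = 0 := by
      rw [hH' p hpn j hjn, h.symm j hjn p hpn]; field_simp; ring
    have e1 : ∑ l ∈ S.erase p, Q i l * H' l j = ∑ l ∈ S, Q i l * H' l j := by
      rw [← add_sum_erase S _ hp, e0]; simp
    rw [e1, sum_congr rfl fun l hl => by rw [hH' l (h.lt hl) j hjn]]
    have e2 : ∀ l, Q i l * (H l j - H l p * H j p / H p p) =
        Q i l * H l j - Q i l * H l p * (H j p / H p p) := fun l => by ring
    simp only [e2, sum_sub_distrib, ← sum_mul]
    rw [h.inv i hiS j hjS, h.inv i hiS p hp, if_neg hip]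
    simp

/-- The diagonal does not increase when an index is removed. -/
theorem erase_diag_le {H' : ℕ → ℕ → ℝ} {p : ℕ} (hpp : 0 ≤ H p p)
    (hH' : ∀ i < n, ∀ j < n, H' i j = H i j - H i p * H j p / H p p) {j : ℕ} (hj : j < n) :
    H' j j ≤ H j j := by
  rw [hH' j hj j hj]
  have : 0 ≤ H j p * H j p / H p p := div_nonneg (mul_self_nonneg _) hpp
  linarith

/-- The scaled identity. -/
theorem diagonal {D : ℝ} (hD : D ≠ 0) (hH : ∀ i < n, ∀ j < n, H i j = if i = j then D else 0) :
    IsInvOn n (range n) (regGram A D⁻¹ 0) H where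
  subset := subset_rfl
  symm i hi j hj := by rw [hH i hi j hj, hH j hj i hi]; simp [eq_comm]
  off i hi hiS := absurd (mem_range.2 hi) hiS
  inv i hi j hj := by
    rw [sum_regGram_mul A _ 0 _ hi (fun l => H l j), hH i (mem_range.1 hi) j (mem_range.1 hj)]
    by_cases hij : i = j <;> simp [hij, hD]

/-- With `v = H a` the form equals `vᵀ Q v`. It keeps the Sherman–Morrison denominator positive. -/
theorem sum_mul_nonneg (h : IsInvOn n (range n) (regGram A ε m) H) (hε : 0 ≤ ε)
    (a : ℕ → ℝ) :
    0 ≤ ∑ j ∈ range n, a j * ∑ l ∈ range n, H j l * a l := by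
  set v : ℕ → ℝ := fun j => ∑ l ∈ range n, H j l * a l with hv
  have hQ : ∀ i ∈ range n, ∑ l ∈ range n, regGram A ε m i l * v l = a i := by
    intro i hi
    simp only [hv, mul_sum]
    rw [sum_comm]
    simp only [← mul_assoc, ← sum_mul]
    rw [sum_congr rfl fun j hj => by rw [h.inv i hi j hj]]
    simpa using fun hc : n ≤ i => absurd (mem_range.1 hi) (not_lt.2 hc)
  have e : ∑ j ∈ range n, a j * v j =
      ∑ i ∈ range n, v i * ∑ l ∈ range n, regGram A ε m i l * v l :=
    sum_congr rfl fun i hi => by rw [hQ i hi, mul_comm]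
  rw [e, sum_sum_regGram_mul]
  simp only [← sq]
  positivity

/-- Adding a row of `A` to the Gram matrix (the Sherman–Morrison formula). -/
theorem add_row {H' : ℕ → ℕ → ℝ} {v : ℕ → ℝ} {σ : ℝ}
    (h : IsInvOn n (range n) (regGram A ε m) H) (hε : 0 ≤ ε)
    (hv : ∀ i < n, v i = ∑ l ∈ range n, H i l * A m l)
    (hσ : σ = 1 + ∑ j ∈ range n, A m j * v j)
    (hH' : ∀ i < n, ∀ j < n, H' i j = H i j - v i * v j / σ) :
    IsInvOn n (range n) (regGram A ε (m + 1)) H' where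
  subset := subset_rfl
  symm i hi j hj := by rw [hH' i hi j hj, hH' j hj i hi, h.symm i hi j hj]; ring
  off i hi hiS := absurd (mem_range.2 hi) hiS
  inv i hi j hj := by
    have hin := mem_range.1 hi
    have hjn := mem_range.1 hj
    have hpos : 0 < σ := by
      have := h.sum_mul_nonneg hε (A m)
      rw [hσ, sum_congr rfl fun j hj => by rw [hv j (mem_range.1 hj)]]
      linarith
    have hQv : ∑ l ∈ range n, regGram A ε m i l * v l = A m i := by
      rw [sum_congr rfl fun l hl => by rw [hv l (mem_range.1 hl), mul_sum]]
      rw [sum_comm]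
      simp only [← mul_assoc, ← sum_mul]
      rw [sum_congr rfl fun j hj => by rw [h.inv i hi j hj]]
      simpa using fun hc : n ≤ i => absurd hin (not_lt.2 hc)
    have hvj : ∑ l ∈ range n, A m l * H l j = v j := by
      rw [hv j hjn]
      exact sum_congr rfl fun l hl => by rw [h.symm l (mem_range.1 hl) j hjn, mul_comm]
    have e : ∀ l ∈ range n, regGram A ε (m + 1) i l * H' l j =
        regGram A ε m i l * H l j + A m i * (A m l * H l j)
          - (v j / σ) * (regGram A ε m i l * v l) - (A m i * v j / σ) * (A m l * v l) := by
      intro l hl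
      rw [hH' l (mem_range.1 hl) j hjn]
      simp only [regGram, sum_range_succ]
      ring
    rw [sum_congr rfl e]
    simp only [sum_add_distrib, sum_sub_distrib, ← mul_sum]
    rw [h.inv i hi j hj, hQv, hvj, show ∑ l ∈ range n, A m l * v l = σ - 1 by linarith]
    field_simp
    ring

end IsInvOn

/-! ### The walk -/

/-- Every set of columns of the `m × n` matrix `A` has a coloring with squared norm at most `V`. -/
def HerBound (m n : ℕ) (A : ℕ → ℕ → ℝ) (V : ℝ) : Prop :=
  ∀ J ⊆ range n, ∃ χ : ℕ → ℝ, (∀ j, χ j = -1 ∨ χ j = 1) ∧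
    ∑ t ∈ range m, (∑ j ∈ J, A t j * χ j) ^ 2 ≤ V

theorem HerBound.nonneg {m n : ℕ} {A : ℕ → ℕ → ℝ} {V : ℝ} (h : HerBound m n A V) : 0 ≤ V := by
  obtain ⟨χ, -, h⟩ := h ∅ (empty_subset _)
  exact le_trans (by positivity) h

theorem HerBound.col_le {m n : ℕ} {A : ℕ → ℕ → ℝ} {V : ℝ} (h : HerBound m n A V) {j : ℕ}
    (hj : j < n) : ∑ t ∈ range m, A t j * A t j ≤ V := by
  obtain ⟨χ, hχ, h⟩ := h {j} (by simpa using hj)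
  refine le_trans (le_of_eq (sum_congr rfl fun t _ => ?_)) h
  rw [sum_singleton]
  rcases hχ j with e | e <;> rw [e] <;> ring

/-- Singletons bound each column. This makes `ε = ‖A‖_F² / n²` satisfy `ε n ≤ V` although `V` is
unknown to the algorithm. -/
theorem HerBound.sum_sq_le {m n : ℕ} {A : ℕ → ℕ → ℝ} {V : ℝ} (h : HerBound m n A V) :
    ∑ t ∈ range m, ∑ j ∈ range n, A t j * A t j ≤ n * V := by
  rw [sum_comm]
  refine (sum_le_card_nsmul _ _ V fun j hj => h.col_le (mem_range.1 hj)).trans (le_of_eq ?_)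
  simp

/-- The size of the support is bounded in terms of the largest diagonal entry of the inverse. -/
theorem IsInvOn.card_le {n m : ℕ} {S : Finset ℕ} {A H : ℕ → ℕ → ℝ} {ε V η : ℝ}
    (h : IsInvOn n S (regGram A ε m) H) (hε : 0 ≤ ε) (hη : 0 ≤ η) (hV : HerBound m n A V)
    (hεV : ε * n ≤ V) (hdiag : ∀ j ∈ S, H j j ≤ η) : (S.card : ℝ) ≤ 128 * η * V := by
  let idx : Fin S.card → ℕ := fun i => (S.equivFin.symm i : ℕ)
  have hmem : ∀ i, idx i ∈ S := fun i => (S.equivFin.symm i).2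
  have hinj : ∀ i j, idx i = idx j ↔ i = j := fun i j => by
    simp only [idx, SetLike.coe_eq_coe, EmbeddingLike.apply_eq_iff_eq]
  have hsum : ∀ f : ℕ → ℝ, ∑ i, f (idx i) = ∑ i ∈ S, f i := fun f => by
    rw [← sum_coe_sort S f]
    exact Equiv.sum_comp S.equivFin.symm (fun i : S => f i)
  have hsqrt : √ε * √ε = ε := Real.mul_self_sqrt hε
  -- The columns of `A` are stacked on `√ε I`, so that their Gram matrix is `Q`; the dual vectors
  -- are the same stacked matrix applied to the columns of `H`, with squared norms `H j j`.
  let a : Fin S.card → EuclideanSpace ℝ (Fin m ⊕ Fin S.card) := fun i =>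
    WithLp.toLp 2 (Sum.elim (fun t => A t (idx i)) (fun l => if l = i then √ε else 0))
  let u : Fin S.card → EuclideanSpace ℝ (Fin m ⊕ Fin S.card) := fun j =>
    WithLp.toLp 2 (Sum.elim (fun t => ∑ l ∈ S, A t l * H l (idx j))
      (fun l => √ε * H (idx l) (idx j)))
  have key : (S.card : ℝ) ≤ 64 * η * (2 * V) := by
    apply card_le_of_rounding S.card a u hη
    · intro i j
      have h1 := h.repr (hmem j) (fun l => if l = idx i then 1 else 0)
      simp only [ite_mul, one_mul, zero_mul, mul_ite, mul_one, mul_zero, sum_ite_eq', hmem i,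
        if_true] at h1
      simp only [a, u, PiLp.inner_apply, Fintype.sum_sum_type, Sum.elim_inl, Sum.elim_inr,
        RCLike.inner_apply, conj_trivial]
      rw [sum_range] at h1
      simp only [mul_ite, mul_zero, sum_ite_eq', mem_univ, if_true]
      rw [sum_congr rfl fun t _ => mul_comm _ _, add_comm]
      rw [show √ε * H (idx i) (idx j) * √ε = ε * H (idx i) (idx j) by
        linear_combination H (idx i) (idx j) * hsqrt, h1]
      simp [eq_comm, hinj]
    · intro j
      have h1 := h.repr_diag (hmem j)
      rw [EuclideanSpace.norm_sq_eq, Fintype.sum_sum_type]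
      simp only [u, Sum.elim_inl, Sum.elim_inr, Real.norm_eq_abs, sq_abs]
      rw [sum_range] at h1
      refine le_trans (le_of_eq ?_) (hdiag _ (hmem j))
      rw [← h1, add_comm]
      congr 1
      rw [hsum (fun l => (√ε * H l (idx j)) ^ 2), mul_sum]
      exact sum_congr rfl fun l _ => by rw [mul_pow, sq, hsqrt]
    · intro w
      let w' : ℕ → Fin 3 := fun j => if hj : j ∈ S then w (S.equivFin ⟨j, hj⟩) else 0
      have hw' : ∀ i, w' (idx i) = w i := fun i => by simp [w', idx]
      -- The index `1` encodes the ternary value `0`: only these coordinates need rounding, and the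
      -- hereditary bound colors exactly them.
      let J := S.filter (fun j => w' j = 1)
      obtain ⟨χ, hχ, hle⟩ := hV J ((filter_subset _ _).trans h.subset)
      let z : ℕ → ℝ := fun j => if w' j = 1 then χ j else 0
      refine ⟨fun i => if w i = 1 then decide (χ (idx i) = 1) else decide (w i = 2), ?_⟩
      have hz : ∀ i, (ternary (w i) - if (if w i = 1 then decide (χ (idx i) = 1)
          else decide (w i = 2)) = true then 1 else -1) = -z (idx i) := by
        intro i
        simp only [z, hw']
        have h3 : w i = 0 ∨ w i = 1 ∨ w i = 2 := by omega
        rcases h3 with h3 | h3 | h3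
        · simp [h3, ternary]
        · rcases hχ (idx i) with e | e <;> norm_num [h3, ternary, e]
        · simp [h3, ternary]; norm_num
      rw [sum_congr rfl fun i _ => by rw [hz i], EuclideanSpace.norm_sq_eq, Fintype.sum_sum_type]
      simp only [Real.norm_eq_abs, sq_abs, WithLp.ofLp_sum, WithLp.ofLp_smul, Finset.sum_apply,
        Pi.smul_apply, smul_eq_mul, a, Sum.elim_inl, Sum.elim_inr]
      have e1 : ∑ t : Fin m, (∑ i, -z (idx i) * A t (idx i)) ^ 2 =
          ∑ t ∈ range m, (∑ j ∈ J, A t j * χ j) ^ 2 := by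
        rw [sum_range]
        refine sum_congr rfl fun t _ => ?_
        rw [hsum (fun i => -z i * A t i), ← neg_sq, ← sum_neg_distrib, sum_filter]
        congr 1
        refine sum_congr rfl fun j _ => ?_
        by_cases hj : w' j = 1 <;> simp [z, hj, mul_comm]
      -- The regularizing coordinates add at most `ε n ≤ V`, so the rounding error is at most `2 V`.
      have e2 : ∑ l : Fin S.card, (∑ i, -z (idx i) * if l = i then √ε else 0) ^ 2 ≤ ε * n := by
        calc _ ≤ ∑ l : Fin S.card, ε := by
              gcongr with l _
              simp only [mul_ite, mul_zero, sum_ite_eq, mem_univ, if_true]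
              rw [mul_pow, sq (√ε), hsqrt]
              have : (-z (idx l)) ^ 2 ≤ 1 := by
                simp only [z]
                split_ifs
                · rcases hχ (idx l) with e | e <;> simp [e]
                · simp
              nlinarith
          _ = ε * S.card := by simp [mul_comm]
          _ ≤ ε * n := by
              gcongr
              simpa using Finset.card_le_card h.subset
      rw [e1]
      linarith
  linarith

/-- The squared norm of `A x`. -/
noncomputable def energy (m n : ℕ) (A : ℕ → ℕ → ℝ) (x : ℕ → ℝ) : ℝ :=
  ∑ t ∈ range m, (∑ j ∈ range n, A t j * x j) ^ 2

/-- The invariant of the walk: `S` is the set of coordinates that are not yet fixed, `H` the inverse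
of the regularized Gram matrix on `S`, and `x` the current fractional coloring. -/
structure WalkInv (m n : ℕ) (A : ℕ → ℕ → ℝ) (ε : ℝ) (S : Finset ℕ) (H : ℕ → ℕ → ℝ)
    (x : ℕ → ℝ) : Prop where
  inv : IsInvOn n S (regGram A ε m) H
  abs_le_one : ∀ j < n, |x j| ≤ 1
  fixed : ∀ j < n, j ∉ S → x j = -1 ∨ x j = 1
  energy_le : ∀ V, HerBound m n A V → ε * n ≤ V → ∃ η > 0, (∀ j ∈ S, H j j ≤ η) ∧
    η * (energy m n A x - ∑ k ∈ Ioc S.card n, 128 * V / k) ≤ ∑ i ∈ S, x i ^ 2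

theorem WalkInv.init {m n : ℕ} {A H : ℕ → ℕ → ℝ} {ε : ℝ} {x : ℕ → ℝ}
    (h : IsInvOn n (range n) (regGram A ε m) H) (hx : ∀ j < n, x j = 0) :
    WalkInv m n A ε (range n) H x where
  inv := h
  abs_le_one j hj := by simp [hx j hj]
  fixed j hj hjS := absurd (mem_range.2 hj) hjS
  energy_le V _ _ := by
    refine ⟨∑ j ∈ range n, |H j j| + 1, by positivity, fun j hj => ?_, ?_⟩
    · have := single_le_sum (f := fun j => |H j j|) (fun _ _ => abs_nonneg _) hj
      linarith [le_abs_self (H j j)]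
    · have e : energy m n A x = 0 := by
        refine sum_eq_zero fun t _ => ?_
        rw [sum_eq_zero fun j hj => by rw [hx j (mem_range.1 hj), mul_zero]]
        simp
      rw [e, card_range, Ioc_self, sum_empty, sub_zero, mul_zero]
      positivity

/-- The right side of `energy_le` is an empty sum, and positivity of `η` lets it be divided out. -/
theorem WalkInv.final {m n : ℕ} {A H : ℕ → ℕ → ℝ} {ε V : ℝ} {x : ℕ → ℝ}
    (h : WalkInv m n A ε ∅ H x) (hV : HerBound m n A V) (hεV : ε * n ≤ V) :
    energy m n A x ≤ ∑ k ∈ Ioc 0 n, 128 * V / k := by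
  obtain ⟨η, hη, -, hle⟩ := h.energy_le V hV hεV
  simp only [sum_empty, card_empty] at hle
  have := nonpos_of_mul_nonpos_right hle hη
  linarith

/-- One step of the walk: move in the direction of the column of `H` with the largest diagonal
entry until the first coordinate reaches `±1`, and fix it. -/
theorem WalkInv.step {m n : ℕ} {A H H' : ℕ → ℕ → ℝ} {ε σ : ℝ} {S : Finset ℕ}
    {x x' y g : ℕ → ℝ} {q p : ℕ} (h : WalkInv m n A ε S H x) (hε : 0 < ε) (hq : q ∈ S)
    (hmax : ∀ j ∈ S, H j j ≤ H q q) (hσ : σ ^ 2 = 1)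
    (hsign : σ * (H q q * ∑ t ∈ range m, (∑ j ∈ range n, A t j * x j) *
      (∑ j ∈ range n, A t j * H j q) - ∑ j ∈ range n, x j * H j q) ≤ 0)
    (hy : ∀ j < n, y j = σ * H j q)
    (hg : ∀ j < n, g j = (√(y j * y j) - x j * y j) / (y j * y j))
    (hp : p < n) (hyp : y p ≠ 0) (hmin : ∀ j < n, y j ≠ 0 → g p ≤ g j)
    (hx' : ∀ j < n, x' j = x j + g p * y j)
    (hH' : ∀ i < n, ∀ j < n, H' i j = H i j - H i p * H j p / H p p) :
    WalkInv m n A ε (S.erase p) H' x' := by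
  have hqn := h.inv.lt hq
  have hσ0 : σ ≠ 0 := by rintro rfl; norm_num at hσ
  have hy0 : ∀ j < n, j ∉ S → y j = 0 := fun j hj hjS => by
    rw [hy j hj, h.inv.off j hj hjS q hqn, mul_zero]
  have hpS : p ∈ S := by
    by_contra hc; exact hyp (hy0 p hp hc)
  have hpp := h.inv.diag_pos hε hpS
  have hqq := h.inv.diag_pos hε hq
  -- `g j` is the time at which coordinate `j` reaches the sign of `y j`: it is `(1 - x j) / y j` or
  -- `(1 + x j) / (-y j)`.
  have hxp : x' p = -1 ∨ x' p = 1 := by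
    rw [hx' p hp, hg p hp, Real.sqrt_mul_self_eq_abs]
    rcases lt_or_gt_of_ne hyp with hlt | hgt
    · left; rw [abs_of_neg hlt]; field_simp; ring
    · right; rw [abs_of_pos hgt]; field_simp; ring
  have hg0 : 0 ≤ g p := by
    rw [hg p hp, Real.sqrt_mul_self_eq_abs]
    apply div_nonneg _ (mul_self_nonneg _)
    have h1 := le_abs_self (x p * y p)
    rw [abs_mul] at h1
    nlinarith [h.abs_le_one p hp, abs_nonneg (y p)]
  refine ⟨h.inv.erase hpS hpp.ne' hH', ?_, ?_, ?_⟩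
  · intro j hj
    have hxj := abs_le.1 (h.abs_le_one j hj)
    rw [hx' j hj]
    by_cases hyj : y j = 0
    · rw [hyj, mul_zero, add_zero]; exact h.abs_le_one j hj
    have hle := hmin j hj hyj
    rw [hg j hj, Real.sqrt_mul_self_eq_abs] at hle
    rcases lt_or_gt_of_ne hyj with hlt | hgt
    · rw [abs_of_neg hlt] at hle
      have e : (-y j - x j * y j) / (y j * y j) = (1 + x j) / (-y j) := by field_simp; ring
      rw [e, le_div_iff₀ (by linarith)] at hle
      exact abs_le.2 ⟨by linarith, by nlinarith⟩
    · rw [abs_of_pos hgt] at hle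
      have e : (y j - x j * y j) / (y j * y j) = (1 - x j) / y j := by field_simp
      rw [e, le_div_iff₀ hgt] at hle
      exact abs_le.2 ⟨by nlinarith, by linarith⟩
  · intro j hj hjS
    by_cases hjp : j = p
    · rw [hjp]; exact hxp
    · have : j ∉ S := fun hc => hjS (mem_erase.2 ⟨hjp, hc⟩)
      rw [hx' j hj, hy0 j hj this, mul_zero, add_zero]
      exact h.fixed j hj this
  · intro V hV hεV
    obtain ⟨η, hη, hdiag, hle⟩ := h.energy_le V hV hεV
    refine ⟨H q q, hqq, fun j hj => ?_, ?_⟩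
    · have hjS := mem_of_mem_erase hj
      exact (IsInvOn.erase_diag_le hpp.le hH' (h.inv.lt hjS)).trans (hmax j hjS)
    have hk : 0 < S.card := card_pos.2 ⟨q, hq⟩
    have hkn : S.card ≤ n := by simpa using Finset.card_le_card h.inv.subset
    have hcard := h.inv.card_le hε.le hqq.le hV hεV hmax
    have hL : ∑ k ∈ Ioc (S.erase p).card n, 128 * V / (k : ℝ) =
        128 * V / S.card + ∑ k ∈ Ioc S.card n, 128 * V / (k : ℝ) := by
      rw [card_erase_of_mem hpS]
      obtain ⟨k, hk'⟩ : ∃ k, S.card = k + 1 := ⟨S.card - 1, by omega⟩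
      rw [hk', Nat.add_sub_cancel]
      exact (Finset.sum_Ioc_consecutive (fun k : ℕ => 128 * V / (k : ℝ)) (Nat.le_succ k)
        (by omega)).symm.trans (by simp)
    have hg_nonneg : 0 ≤ ∑ i ∈ S, x i ^ 2 := by positivity
    -- Lowering `η` to `H q q` is harmless: a nonnegative excess energy gets a smaller factor, and a
    -- negative one makes the left side nonpositive.
    have hold : H q q * (energy m n A x - ∑ k ∈ Ioc S.card n, 128 * V / (k : ℝ)) ≤
        ∑ i ∈ S, x i ^ 2 := by
      rcases le_total 0 (energy m n A x - ∑ k ∈ Ioc S.card n, 128 * V / (k : ℝ)) with h0 | h0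
      · exact (mul_le_mul_of_nonneg_right (hdiag q hq) h0).trans hle
      · exact (mul_nonpos_of_nonneg_of_nonpos hqq.le h0).trans hg_nonneg
    set B := ∑ t ∈ range m, (∑ j ∈ range n, A t j * x j) * (∑ j ∈ range n, A t j * H j q)
      with hB
    set X := ∑ j ∈ range n, x j * H j q with hX
    have hE : energy m n A x' = energy m n A x + 2 * (g p * σ) * B +
        (g p) ^ 2 * ∑ t ∈ range m, (∑ j ∈ range n, A t j * H j q) ^ 2 := by
      have e : ∀ t, ∑ j ∈ range n, A t j * x' j = ∑ j ∈ range n, A t j * x j +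
          g p * σ * ∑ j ∈ range n, A t j * H j q := by
        intro t
        rw [mul_sum, ← sum_add_distrib]
        refine sum_congr rfl fun j hj => ?_
        rw [hx' j (mem_range.1 hj), hy j (mem_range.1 hj)]; ring
      simp only [energy, e, hB, mul_sum (s := range m), ← sum_add_distrib]
      refine sum_congr rfl fun t _ => ?_
      linear_combination (g p) ^ 2 * (∑ j ∈ range n, A t j * H j q) ^ 2 * hσ
    have hXS : X = ∑ j ∈ S, x j * H j q := h.inv.sum_mul_col hq x
    have hxx : ∑ i ∈ S, x' i ^ 2 = ∑ i ∈ S, x i ^ 2 + 2 * (g p * σ) * X +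
        (g p) ^ 2 * ∑ i ∈ S, H i q ^ 2 := by
      rw [hXS]
      simp only [mul_sum, ← sum_add_distrib]
      refine sum_congr rfl fun j hj => ?_
      rw [hx' j (h.inv.lt hj), hy j (h.inv.lt hj)]
      linear_combination (g p) ^ 2 * (H j q) ^ 2 * hσ
    have hAH : ∑ t ∈ range m, (∑ j ∈ range n, A t j * H j q) ^ 2 ≤ H q q := by
      have := h.inv.repr_diag hq
      have h0 : 0 ≤ ε * ∑ i ∈ S, H i q ^ 2 := by positivity
      simp only [h.inv.sum_mul_col hq]
      linarith
    have hHq : H q q ^ 2 ≤ ∑ i ∈ S, H i q ^ 2 :=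
      single_le_sum (f := fun i => H i q ^ 2) (fun _ _ => sq_nonneg _) hq
    have hsplit : ∑ i ∈ S, x' i ^ 2 = 1 + ∑ i ∈ S.erase p, x' i ^ 2 := by
      rw [← add_sum_erase S _ hpS]
      rcases hxp with e | e <;> rw [e] <;> norm_num
    -- The new summand of the allowance, multiplied by `H q q`, pays for the lost term `x' p ^ 2 =
    -- 1`.
    have hone : 1 ≤ H q q * (128 * V / S.card) := by
      have : (0 : ℝ) < S.card := by exact_mod_cast hk
      rw [← mul_div_assoc, le_div_iff₀ this]
      linarith
    -- `h1` controls the first-order terms; `h2` and `h3` compare the second-order terms through `(H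
    -- q q)²`.
    have h1 : (g p) * (σ * (H q q * B - X)) ≤ 0 := mul_nonpos_of_nonneg_of_nonpos hg0 hsign
    have h2 := mul_le_mul_of_nonneg_left hHq (sq_nonneg (g p))
    have h3 := mul_le_mul_of_nonneg_left hAH (mul_nonneg hqq.le (sq_nonneg (g p)))
    rw [hL, hE]
    nlinarith

namespace RealRAM

/-! ### Total correctness with time bounds -/

/-- Started in `s`, the program `p` halts within `T` steps in a state that satisfies `Q`. -/
def Ends (p : Prog) (s : State) (T : ℕ) (Q : State → Prop) : Prop :=
  ∃ t s', Run p s t s' ∧ t ≤ T ∧ Q s'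

/-- `s'` agrees with `s` outside of the registers in `R` and the arrays in `L`. -/
structure Frame (R L : List ℕ) (s s' : State) : Prop where
  idx : ∀ r, r ∉ R → s'.idx r = s.idx r
  arr : ∀ a, a ∉ L → s'.arr a = s.arr a

theorem State.writeIdx_idx (s : State) (r v r' : ℕ) :
    (s.writeIdx r v).idx r' = if r' = r then v else s.idx r' := by
  simp [State.writeIdx, Function.update_apply]

theorem State.writeIdx_arr (s : State) (r v : ℕ) : (s.writeIdx r v).arr = s.arr := rfl

theorem State.writeCell_idx (s : State) (a i j : ℕ) (v : ℝ) :
    (s.writeCell a i j v).idx = s.idx := rfl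

theorem State.writeCell_arr (s : State) (a i j : ℕ) (v : ℝ) (a' i' j' : ℕ) :
    (s.writeCell a i j v).arr a' i' j' =
      if a' = a ∧ i' = i ∧ j' = j then v else s.arr a' i' j' := by
  simp only [State.writeCell, Function.update_apply]
  by_cases ha : a' = a <;> by_cases hi : i' = i <;> by_cases hj : j' = j <;>
    simp [ha, hi, hj]

namespace Frame

variable {R L R' L' : List ℕ} {s s' s'' : State}

theorem refl (R L : List ℕ) (s : State) : Frame R L s s := ⟨fun _ _ => rfl, fun _ _ => rfl⟩

theorem trans (h : Frame R L s s') (h' : Frame R L s' s'') : Frame R L s s'' :=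
  ⟨fun r hr => (h'.idx r hr).trans (h.idx r hr), fun a ha => (h'.arr a ha).trans (h.arr a ha)⟩

theorem mono (h : Frame R L s s') (hR : R ⊆ R') (hL : L ⊆ L') : Frame R' L' s s' :=
  ⟨fun r hr => h.idx r fun hc => hr (hR hc), fun a ha => h.arr a fun hc => ha (hL hc)⟩

theorem writeIdx (h : Frame R L s s') {r : ℕ} (hr : r ∈ R) (v : ℕ) :
    Frame R L s (s'.writeIdx r v) :=
  ⟨fun r' hr' => by
    rw [State.writeIdx_idx, if_neg (by rintro rfl; exact hr' hr)]; exact h.idx r' hr', h.arr⟩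

theorem writeCell (h : Frame R L s s') {a : ℕ} (ha : a ∈ L) (i j : ℕ) (v : ℝ) :
    Frame R L s (s'.writeCell a i j v) :=
  ⟨h.idx, fun a' ha' => by
    funext i' j'
    rw [State.writeCell_arr, if_neg (by rintro ⟨rfl, -⟩; exact ha' ha), h.arr a' ha']⟩

end Frame

namespace Ends

variable {p q : Prog} {s : State} {T T' : ℕ} {Q Q' : State → Prop}

theorem mono (h : Ends p s T Q) (hT : T ≤ T') (hQ : ∀ s', Q s' → Q' s') : Ends p s T' Q' := by
  obtain ⟨t, s', hr, ht, hs⟩ := h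
  exact ⟨t, s', hr, ht.trans hT, hQ _ hs⟩

theorem of_le (hT : T ≤ T') (h : Ends p s T Q) : Ends p s T' Q := h.mono hT fun _ h => h

theorem imp (hQ : ∀ s', Q s' → Q' s') (h : Ends p s T Q) : Ends p s T Q' := h.mono le_rfl hQ

theorem skip (h : Q s) : Ends .skip s 1 Q := ⟨_, _, .skip s, le_rfl, h⟩

theorem setIdx {r : ℕ} {e : IdxExpr} (h : Q (s.writeIdx r (e.eval s))) :
    Ends (.setIdx r e) s (e.cost + 1) Q := ⟨_, _, .setIdx s r e, le_rfl, h⟩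

theorem setCell {a : ℕ} {i j : IdxExpr} {e : RealExpr}
    (h : Q (s.writeCell a (i.eval s) (j.eval s) (e.eval s))) :
    Ends (.setCell a i j e) s (i.cost + j.cost + e.cost + 1) Q :=
  ⟨_, _, .setCell s a i j e, le_rfl, h⟩

theorem seq (h : Ends p s T Q') (h' : ∀ s', Q' s' → Ends q s' T' Q) :
    Ends (.seq p q) s (T + T') Q := by
  obtain ⟨t, s', hr, ht, hs⟩ := h
  obtain ⟨t', s'', hr', ht', hs'⟩ := h' s' hs
  exact ⟨_, _, .seq hr hr', Nat.add_le_add ht ht', hs'⟩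

theorem branch {b : Test} (h : b.Holds s → Ends p s T Q) (h' : ¬ b.Holds s → Ends q s T Q) :
    Ends (.branch b p q) s (b.cost + T + 1) Q := by
  by_cases hb : b.Holds s
  · obtain ⟨t, s', hr, ht, hs⟩ := h hb
    exact ⟨_, _, .branchTrue hb hr, by omega, hs⟩
  · obtain ⟨t, s', hr, ht, hs⟩ := h' hb
    exact ⟨_, _, .branchFalse hb hr, by omega, hs⟩

end Ends

/-! ### Loops -/

/-- Run `p` with the register `r` taking the values `0, 1, …` below the value of register `b`. -/
def forLoop (r b : ℕ) (p : Prog) : Prog :=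
  .seq (.setIdx r (.const 0))
    (.loop (.idxLt (.reg r) (.reg b)) (.seq p (.setIdx r (.add (.reg r) (.const 1)))))

/-- Per round, the test and loop cost `4` and the increment `4`; initialization costs `2` and the
failing test `4`. The invariant is taken after the increment of `r`. -/
theorem Ends.forLoop {r b N c : ℕ} {p : Prog} {s : State} (I : ℕ → State → Prop)
    (hrb : b ≠ r) (hN : s.idx b = N) (h0 : I 0 (s.writeIdx r 0))
    (hstep : ∀ k < N, ∀ s, I k s → s.idx r = k → s.idx b = N →
      Ends p s c fun s' => s'.idx r = k ∧ s'.idx b = N ∧ I (k + 1) (s'.writeIdx r (k + 1))) :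
    Ends (forLoop r b p) s (N * (c + 8) + 6) (I N) := by
  have key : ∀ d k s, k + d = N → I k s → s.idx r = k → s.idx b = N →
      Ends (.loop (.idxLt (.reg r) (.reg b)) (.seq p (.setIdx r (.add (.reg r) (.const 1)))))
        s (d * (c + 8) + 4) (I N) := by
    intro d
    induction d with
    | zero =>
      intro k s hk hI hr hb
      obtain rfl : k = N := by omega
      exact ⟨_, _, .loopFalse (by simp [Test.Holds, IdxExpr.eval, hr, hb]),
        by simp [Test.cost, IdxExpr.cost], hI⟩
    | succ d ih =>
      intro k s hk hI hr hb
      obtain ⟨t, s', hrun, ht, hr', hb', hI'⟩ := hstep k (by omega) s hI hr hb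
      obtain ⟨t', s'', hrun', ht', hI''⟩ := ih (k + 1) (s'.writeIdx r (k + 1)) (by omega) hI'
        (by simp [State.writeIdx_idx]) (by simp [State.writeIdx_idx, hrb, hb'])
      have hset : Run (.setIdx r (.add (.reg r) (.const 1))) s' 4 (s'.writeIdx r (k + 1)) := by
        have := Run.setIdx s' r (.add (.reg r) (.const 1))
        simpa [IdxExpr.eval, IdxExpr.cost, hr'] using this
      refine ⟨_, _, .loopTrue ?_ (.seq hrun hset) hrun', ?_, hI''⟩
      · simp only [Test.Holds, IdxExpr.eval, hr, hb]; omega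
      · simp only [Test.cost, IdxExpr.cost, Nat.succ_mul]; omega
  have := Ends.seq (p := .setIdx r (.const 0)) (s := s) (Q' := fun s' => s' = s.writeIdx r 0)
    (Ends.setIdx (by simp [IdxExpr.eval])) (fun s' hs' => key N 0 s' (by omega) (hs' ▸ h0)
      (by simp [hs', State.writeIdx_idx]) (by simp [hs', State.writeIdx_idx, hrb, hN]))
  refine this.mono ?_ fun _ h => h
  simp only [IdxExpr.cost]; omega

/-- A single real number, stored in the entry `(0, 0)` of the array `a`. -/
def scalar (a : ℕ) : RealExpr := .cell a (.const 0) (.const 0)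

/-- Assign to the scalar `a`. -/
def setScalar (a : ℕ) (e : RealExpr) : Prog := .setCell a (.const 0) (.const 0) e

theorem Ends.setScalar {s : State} {Q : State → Prop} {a : ℕ} {e : RealExpr}
    (h : Q (s.writeCell a 0 0 (e.eval s))) : Ends (setScalar a e) s (e.cost + 3) Q :=
  (Ends.setCell h).mono (by simp [IdxExpr.cost]; omega) fun _ h => h

/-- Sum up, over the values of the register `r`, the values that `e` has after running `p`. -/
def accLoop (r b a : ℕ) (p : Prog) (e : RealExpr) : Prog :=
  .seq (setScalar a (.const 0))
    (forLoop r b (.seq p (setScalar a (.add (scalar a) e))))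

theorem Ends.accLoop {r b a N c : ℕ} {p : Prog} {e : RealExpr} {s : State} {R L : List ℕ}
    (f : ℕ → ℝ) (hb : b ∉ r :: R) (hr : r ∉ R) (ha : a ∉ L) (hN : s.idx b = N)
    (hp : ∀ k < N, ∀ s', Frame (r :: R) (a :: L) s s' → s'.idx r = k →
      Ends p s' c fun s'' => Frame R L s' s'' ∧ e.eval s'' = f k) :
    Ends (accLoop r b a p e) s (N * (c + e.cost + 15) + 10) fun s' =>
      Frame (r :: R) (a :: L) s s' ∧ s'.arr a 0 0 = ∑ k ∈ range N, f k := by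
  have hbr : b ≠ r := fun h => hb (h ▸ List.mem_cons_self)
  have hbR : b ∉ R := fun h => hb (List.mem_cons_of_mem _ h)
  refine (Ends.seq (Q' := fun s' => Frame (r :: R) (a :: L) s s' ∧ s'.arr a 0 0 = 0)
    (Ends.setScalar ⟨(Frame.refl _ _ s).writeCell List.mem_cons_self _ _ _, ?_⟩)
    fun s₁ ⟨f₁, h₁⟩ => Ends.forLoop (N := N) (c := c + (e.cost + 7)) (fun k s' =>
      Frame (r :: R) (a :: L) s s' ∧ s'.arr a 0 0 = ∑ k ∈ range k, f k) hbr
      (by rw [f₁.idx b hb, hN]) ⟨f₁.writeIdx List.mem_cons_self _, by simpa [State.writeIdx_arr] using h₁⟩ ?_).mono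
    ?_ fun _ h => h
  · simp [State.writeCell_arr, RealExpr.eval]
  · rintro k hk s₂ ⟨f₂, h₂⟩ hrk hbN
    refine (Ends.seq (hp k hk s₂ f₂ hrk) fun s₃ ⟨f₃, h₃⟩ =>
      Ends.setScalar ⟨?_, ?_, ?_, ?_⟩).mono ?_ fun _ h => h
    · simp only [RealExpr.cost, scalar, IdxExpr.cost]; omega
    · rw [State.writeCell_idx, f₃.idx r hr, hrk]
    · rw [State.writeCell_idx, f₃.idx b hbR, hbN]
    · exact ((f₂.trans (f₃.mono (List.subset_cons_self _ _) (List.subset_cons_self _ _))).writeCell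
        List.mem_cons_self _ _ _).writeIdx List.mem_cons_self _
    · simp [State.writeIdx_arr, State.writeCell_arr, RealExpr.eval, scalar, IdxExpr.eval, h₃,
        f₃.arr a ha, h₂, sum_range_succ]
  · simp only [RealExpr.cost]
    have : c + (e.cost + 7) + 8 = c + e.cost + 15 := by omega
    rw [this]; omega

/-- Sum up the values of `e` over the values of the register `r`. -/
def sumLoop (r b a : ℕ) (e : RealExpr) : Prog := accLoop r b a .skip e

theorem Ends.sumLoop {r b a N : ℕ} {e : RealExpr} {s : State} (f : ℕ → ℝ) (hb : b ≠ r)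
    (hN : s.idx b = N)
    (he : ∀ k < N, ∀ s', Frame [r] [a] s s' → s'.idx r = k → e.eval s' = f k) :
    Ends (sumLoop r b a e) s (N * (e.cost + 16) + 10) fun s' =>
      Frame [r] [a] s s' ∧ s'.arr a 0 0 = ∑ k ∈ range N, f k :=
  (Ends.accLoop (R := []) (L := []) (c := 1) f (by simpa using hb) (by simp) (by simp) hN
    fun k hk s' hf hr => Ends.skip ⟨Frame.refl _ _ _, he k hk s' hf hr⟩).mono
    (by rw [show 1 + e.cost + 15 = e.cost + 16 by omega]) fun _ h => h

/-- For every value of the register `r`, run `p` and then write the value of `e` to the entry of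
the vector `a` at this index. -/
def mapLoop (r b a : ℕ) (p : Prog) (e : RealExpr) : Prog :=
  forLoop r b (.seq p (.setCell a (.const 0) (.reg r) e))

/-- Entry `k` is still the original one when its turn comes, so `e` may read it; this permits
updating the coloring in place. -/
theorem Ends.mapLoop {r b a N c : ℕ} {p : Prog} {e : RealExpr} {s : State} {R L : List ℕ}
    (f : ℕ → ℝ) (hb : b ∉ r :: R) (hr : r ∉ R) (ha : a ∉ L) (hN : s.idx b = N)
    (hp : ∀ k < N, ∀ s', Frame (r :: R) (a :: L) s s' → s'.idx r = k →
      s'.arr a 0 k = s.arr a 0 k →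
      Ends p s' c fun s'' => Frame R L s' s'' ∧ e.eval s'' = f k) :
    Ends (mapLoop r b a p e) s (N * (c + e.cost + 11) + 6) fun s' =>
      Frame (r :: R) (a :: L) s s' ∧ ∀ k < N, s'.arr a 0 k = f k := by
  have hbr : b ≠ r := fun h => hb (h ▸ List.mem_cons_self)
  have hbR : b ∉ R := fun h => hb (List.mem_cons_of_mem _ h)
  refine (Ends.forLoop (N := N) (c := c + (e.cost + 3)) (fun k s' =>
      Frame (r :: R) (a :: L) s s' ∧
        ∀ j, s'.arr a 0 j = if j < k then f j else s.arr a 0 j) hbr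
      hN ⟨(Frame.refl _ _ s).writeIdx List.mem_cons_self _, by simp [State.writeIdx_arr]⟩ ?_).mono
    ?_ fun s' h => ⟨h.1, fun k hk => by rw [h.2 k, if_pos hk]⟩
  · rintro k hk s₂ ⟨f₂, h₂⟩ hrk hbN
    refine (Ends.seq (hp k hk s₂ f₂ hrk (by simp [h₂])) fun s₃ ⟨f₃, h₃⟩ =>
      Ends.setCell ⟨?_, ?_, ?_, ?_⟩).mono ?_ fun _ h => h
    · simp only [IdxExpr.cost]; omega
    · rw [State.writeCell_idx, f₃.idx r hr, hrk]
    · rw [State.writeCell_idx, f₃.idx b hbR, hbN]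
    · exact ((f₂.trans (f₃.mono (List.subset_cons_self _ _) (List.subset_cons_self _ _))).writeCell
        List.mem_cons_self _ _ _).writeIdx List.mem_cons_self _
    · intro j
      simp only [State.writeIdx_arr, State.writeCell_arr, IdxExpr.eval, h₃, f₃.arr a ha, h₂,
        f₃.idx r hr, hrk, true_and]
      grind
  · have : c + (e.cost + 3) + 8 = c + e.cost + 11 := by omega
    rw [this]

/-- Write to the register `d` the value of the register `r` whenever the test `b` succeeds. -/
def searchLoop (r n d : ℕ) (b : Test) : Prog :=
  forLoop r n (.branch b (.setIdx d (.reg r)) .skip)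

/-- If the test compares the entry at index `r` with the one at index `d`, then the loop finds a
maximum. -/
theorem Ends.searchLoop {r n d N : ℕ} {b : Test} {s : State} (g : ℕ → ℝ) (elig : ℕ → Prop)
    (hnr : n ≠ r) (hnd : n ≠ d) (hrd : r ≠ d) (hN : s.idx n = N)
    (hb : ∀ k < N, ∀ s', Frame [r, d] [] s s' → s'.idx r = k →
      (b.Holds s' ↔ elig k ∧ g (s'.idx d) < g k)) :
    Ends (searchLoop r n d b) s (N * (b.cost + 11) + 6) fun s' =>
      Frame [r, d] [] s s' ∧ (s'.idx d = s.idx d ∨ s'.idx d < N ∧ elig (s'.idx d)) ∧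
        ∀ k < N, elig k → g k ≤ g (s'.idx d) := by
  refine (Ends.forLoop (N := N) (c := b.cost + 3) (fun k s' =>
      Frame [r, d] [] s s' ∧ (s'.idx d = s.idx d ∨ s'.idx d < N ∧ elig (s'.idx d)) ∧
        ∀ j < k, elig j → g j ≤ g (s'.idx d)) hnr hN
      ⟨(Frame.refl _ _ s).writeIdx (by simp) _, ?_, by simp⟩ ?_).mono ?_ fun _ h => h
  · simp [State.writeIdx_idx, hrd.symm]
  · rintro k hk s₂ ⟨f₂, h₂, h₃⟩ hrk hnN
    have hiff := hb k hk s₂ f₂ hrk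
    refine Ends.branch (T := 2) (fun ht => ?_) (fun ht => ?_)
    · obtain ⟨he, hlt⟩ := hiff.1 ht
      refine Ends.setIdx ⟨?_, ?_, (f₂.writeIdx (by simp) _).writeIdx (by simp) _, ?_, ?_⟩
      · simp [State.writeIdx_idx, hrd, hrk]
      · simp [State.writeIdx_idx, hnd, hnN]
      · simp [State.writeIdx_idx, hrd.symm, IdxExpr.eval, hrk, hk, he]
      · simp only [State.writeIdx_idx, hrd.symm, IdxExpr.eval, hrk, if_false, if_true]
        intro j hj hej
        rcases Nat.lt_succ_iff_lt_or_eq.1 hj with h | h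
        · exact (h₃ j h hej).trans hlt.le
        · rw [h]
    · refine (Ends.skip ⟨hrk, hnN, f₂.writeIdx (by simp) _, ?_, ?_⟩).mono one_le_two fun _ h => h
      · simpa [State.writeIdx_idx, hrd.symm] using h₂
      · simp only [State.writeIdx_idx, hrd.symm, if_false]
        intro j hj hej
        rcases Nat.lt_succ_iff_lt_or_eq.1 hj with h | h
        · exact h₃ j h hej
        · subst h
          exact not_lt.1 fun hc => ht (hiff.2 ⟨hej, hc⟩)
  · rw [show b.cost + 3 + 8 = b.cost + 11 by omega]

end RealRAM

namespace RealRAM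

/-! ### The program

Register `0` and `1` hold the dimensions, `2`, `3`, `4` are loop counters, `5` and `6` hold the
chosen column and the coordinate that is fixed next. Array `0` holds the matrix `A`, array `1` the
coloring, array `2` the inverse `H`; array `4` and scalar `5` describe the rank one update of `H`,
arrays `11` and `12` hold the direction of a step and the step lengths, and the remaining arrays
hold scalars. -/

/-- Subtract the rank one matrix `v vᵀ / σ` from `H`. -/
def rankOneUpdate : Prog :=
  forLoop 3 1 (forLoop 4 1 (.setCell 2 (.reg 3) (.reg 4)
    (.sub (.cell 2 (.reg 3) (.reg 4))
      (.div (.mul (.cell 4 (.const 0) (.reg 3)) (.cell 4 (.const 0) (.reg 4))) (scalar 5)))))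

theorem ends_rankOneUpdate {n : ℕ} {s : State} (hn : s.idx 1 = n) :
    Ends rankOneUpdate s (n * (n * 26 + 14) + 6) fun s' => Frame [3, 4] [2] s s' ∧
      ∀ i < n, ∀ j < n, s'.arr 2 i j =
        s.arr 2 i j - s.arr 4 0 i * s.arr 4 0 j / s.arr 5 0 0 := by
  refine (Ends.forLoop (N := n) (c := n * 26 + 6) (fun k s' => Frame [3, 4] [2] s s' ∧
    ∀ i j, j < n → s'.arr 2 i j = if i < k then
        s.arr 2 i j - s.arr 4 0 i * s.arr 4 0 j / s.arr 5 0 0 else s.arr 2 i j)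
    (by decide) hn ⟨(Frame.refl _ _ _).writeIdx (by simp) _, by simp [State.writeIdx_arr]⟩ ?_).mono
    le_rfl fun s' h => ⟨h.1, fun i hi j hj => by rw [h.2 i j hj, if_pos hi]⟩
  rintro k hk s₁ ⟨f₁, h₁⟩ hr₁ hn₁
  -- The updated entries are those preceding `(k, l)` in row-major order.
  refine (Ends.forLoop (N := n) (c := 18) (fun l s' => Frame [3, 4] [2] s s' ∧ s'.idx 3 = k ∧
    ∀ i j, j < n → s'.arr 2 i j = if i < k ∨ i = k ∧ j < l then
        s.arr 2 i j - s.arr 4 0 i * s.arr 4 0 j / s.arr 5 0 0 else s.arr 2 i j)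
    (by decide) hn₁ ⟨f₁.writeIdx (by simp) _, by simpa [State.writeIdx_idx] using hr₁,
      by simpa [State.writeIdx_arr] using h₁⟩ ?_).mono le_rfl
      fun s' h => ⟨h.2.1, by rw [h.1.idx 1 (by simp), hn], h.1.writeIdx (by simp) _,
        fun i j hj => ?_⟩
  · rintro l hl s₂ ⟨f₂, h₂, h₃⟩ hr₂ hn₂
    refine (Ends.setCell ⟨hr₂, hn₂, (f₂.writeCell (by simp) _ _ _).writeIdx (by simp) _, ?_, ?_⟩)
    · simpa [State.writeIdx_idx, State.writeCell_idx] using h₂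
    · intro i j hj
      simp only [State.writeIdx_arr, State.writeCell_arr, IdxExpr.eval, RealExpr.eval, scalar, h₂,
        hr₂, f₂.arr 4 (by simp), f₂.arr 5 (by simp), h₃ i j hj, h₃ k l hl, true_and]
      by_cases hi : i = k
      · subst hi
        by_cases hjl : j = l
        · subst hjl; simp
        · have : j < l ↔ j < l + 1 := by omega
          simp [hjl, this]
      · simp [hi]
  · rw [State.writeIdx_arr, h.2.2 i j hj]
    have : (i < k ∨ i = k ∧ j < n) ↔ i < k + 1 := by omega
    simp only [this]

/-- Find the largest diagonal entry of `H`. -/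
def findPivot : Prog :=
  .seq (.setIdx 5 (.const 0))
    (searchLoop 3 1 5 (.realLt (.cell 2 (.reg 5) (.reg 5)) (.cell 2 (.reg 3) (.reg 3))))

theorem ends_findPivot {n : ℕ} {s : State} (hn : s.idx 1 = n) (hpos : 1 ≤ n) :
    Ends findPivot s (n * 18 + 8) fun s' => Frame [3, 5] [] s s' ∧ s'.idx 5 < n ∧
      ∀ j < n, s.arr 2 j j ≤ s.arr 2 (s'.idx 5) (s'.idx 5) := by
  refine Ends.of_le ?_ (Ends.seq (Q' := fun s' => Frame [3, 5] [] s s' ∧ s'.idx 5 = 0)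
    (Ends.setIdx ⟨(Frame.refl _ _ _).writeIdx (by simp) _, by
      simp [State.writeIdx_idx, IdxExpr.eval]⟩) fun s₁ ⟨f₁, h₁⟩ =>
    Ends.imp ?_ (Ends.searchLoop (N := n) (fun j => s.arr 2 j j) (fun _ => True) (by decide)
      (by decide) (by decide) (by rw [f₁.idx 1 (by simp), hn]) fun k hk s' f' hk' => ?_))
  · simp only [IdxExpr.cost, Test.cost, RealExpr.cost]; omega
  · rintro s₂ ⟨f₂, h₂, h₃⟩
    refine ⟨f₁.trans f₂, ?_, by simpa using h₃⟩
    rcases h₂ with h₂ | h₂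
    · omega
    · exact h₂.1
  · simp [Test.Holds, RealExpr.eval, IdxExpr.eval, f'.arr, f₁.arr, hk']

/-- Compute the direction of the step: the chosen column of `H`, with the sign for which the
potential does not increase. -/
def findDirection : Prog :=
  .seq (accLoop 3 0 6
    (.seq (sumLoop 4 1 7 (.mul (.cell 0 (.reg 3) (.reg 4)) (.cell 1 (.const 0) (.reg 4))))
      (sumLoop 4 1 8 (.mul (.cell 0 (.reg 3) (.reg 4)) (.cell 2 (.reg 4) (.reg 5)))))
    (.mul (scalar 7) (scalar 8))) <|
  .seq (sumLoop 3 1 9 (.mul (.cell 1 (.const 0) (.reg 3)) (.cell 2 (.reg 3) (.reg 5)))) <|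
  .seq (.branch (.realLt (.const 0)
      (.sub (.mul (.cell 2 (.reg 5) (.reg 5)) (scalar 6)) (scalar 9)))
    (setScalar 10 (.const (-1))) (setScalar 10 (.const 1))) <|
  mapLoop 3 1 11 .skip (.mul (scalar 10) (.cell 2 (.reg 3) (.reg 5)))

theorem ends_findDirection {m n : ℕ} {s : State} (hm : s.idx 0 = m) (hn : s.idx 1 = n) :
    Ends findDirection s (m * (n * 46 + 42) + n * 42 + 70) fun s' =>
      Frame [3, 4] [6, 7, 8, 9, 10, 11] s s' ∧ ∃ σ : ℝ, σ ^ 2 = 1 ∧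
      σ * (s.arr 2 (s.idx 5) (s.idx 5) * ∑ t ∈ range m,
        (∑ j ∈ range n, s.arr 0 t j * s.arr 1 0 j) *
        (∑ j ∈ range n, s.arr 0 t j * s.arr 2 j (s.idx 5)) -
        ∑ j ∈ range n, s.arr 1 0 j * s.arr 2 j (s.idx 5)) ≤ 0 ∧
      ∀ j < n, s'.arr 11 0 j = σ * s.arr 2 j (s.idx 5) := by
  set B := ∑ t ∈ range m, (∑ j ∈ range n, s.arr 0 t j * s.arr 1 0 j) *
        (∑ j ∈ range n, s.arr 0 t j * s.arr 2 j (s.idx 5)) with hB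
  set X := ∑ j ∈ range n, s.arr 1 0 j * s.arr 2 j (s.idx 5) with hX
  refine Ends.of_le ?_ (Ends.seq (Ends.accLoop (N := m) (c := n * 46 + 20)
      (R := [4]) (L := [7, 8])
      (fun t => (∑ j ∈ range n, s.arr 0 t j * s.arr 1 0 j) *
        (∑ j ∈ range n, s.arr 0 t j * s.arr 2 j (s.idx 5))) (by decide) (by decide) (by decide) hm
      fun t ht s' f' ht' => Ends.of_le ?_ (Ends.seq
        (Ends.sumLoop (N := n) (fun j => s.arr 0 t j * s.arr 1 0 j) (by decide)
          (by rw [f'.idx 1 (by simp), hn]) fun k hk s₁ f₁ hk₁ => ?_) fun s₁ ⟨f₁, h₁⟩ =>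
        Ends.imp ?_ (Ends.sumLoop (N := n) (fun j => s.arr 0 t j * s.arr 2 j (s.idx 5)) (by decide)
          (by rw [f₁.idx 1 (by simp), f'.idx 1 (by simp), hn]) fun k hk s₂ f₂ hk₂ => ?_)))
    fun s₁ ⟨f₁, h₁⟩ => Ends.seq (Ends.sumLoop (N := n)
      (fun j => s.arr 1 0 j * s.arr 2 j (s.idx 5)) (by decide) (by rw [f₁.idx 1 (by simp), hn])
      fun k hk s₂ f₂ hk₂ => ?_)
    fun s₂ ⟨f₂, h₂⟩ => Ends.seq (Q' := fun s' => Frame [] [10] s₂ s' ∧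
      ∃ σ : ℝ, σ ^ 2 = 1 ∧ σ * (s.arr 2 (s.idx 5) (s.idx 5) * B - X) ≤ 0 ∧ s'.arr 10 0 0 = σ)
      (Ends.branch (fun hb => Ends.setScalar ⟨(Frame.refl _ _ _).writeCell (by simp) _ _ _, -1, by
        norm_num, ?_, ?_⟩) fun hb => Ends.setScalar
        ⟨(Frame.refl _ _ _).writeCell (by simp) _ _ _, 1, by norm_num, ?_, ?_⟩)
    fun s₃ ⟨f₃, σ, hσ, hle, h₃⟩ => Ends.imp ?_ (Ends.mapLoop (N := n) (c := 1) (R := []) (L := [])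
      (fun j => σ * s.arr 2 j (s.idx 5)) (by decide) (by decide) (by decide)
      (by rw [f₃.idx 1 (by simp), f₂.idx 1 (by simp), f₁.idx 1 (by simp), hn])
      fun k hk s' f' hk' _ => Ends.skip ⟨Frame.refl _ _ _, ?_⟩))
  · simp only [IdxExpr.cost, Test.cost, RealExpr.cost, scalar]; ring_nf; omega
  · simp only [IdxExpr.cost, RealExpr.cost]; omega
  · simp [RealExpr.eval, IdxExpr.eval, f₁.arr, f₁.idx, f'.arr, hk₁, ht']
  · rintro s₂ ⟨f₂, h₂⟩
    refine ⟨(f₁.mono (by simp) (by simp)).trans (f₂.mono (by simp) (by simp)), ?_⟩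
    simp [RealExpr.eval, IdxExpr.eval, scalar, h₂, f₂.arr, h₁]
  · simp [RealExpr.eval, IdxExpr.eval, f₂.arr, f₂.idx, f₁.arr, f₁.idx, f'.arr, f'.idx, hk₂, ht']
  · simp [RealExpr.eval, IdxExpr.eval, f₂.arr, f₂.idx, f₁.arr, f₁.idx, hk₂]
  · have : 0 < s.arr 2 (s.idx 5) (s.idx 5) * B - X := by
      simpa [Test.Holds, RealExpr.eval, IdxExpr.eval, scalar, f₂.arr, f₂.idx, f₁.arr, f₁.idx, h₁,
        h₂] using hb
    linarith
  · simp [State.writeCell_arr, RealExpr.eval]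
  · have : s.arr 2 (s.idx 5) (s.idx 5) * B - X ≤ 0 := by
      simpa [Test.Holds, RealExpr.eval, IdxExpr.eval, scalar, f₂.arr, f₂.idx, f₁.arr, f₁.idx, h₁,
        h₂] using hb
    linarith
  · simp [State.writeCell_arr, RealExpr.eval]
  · rintro s₄ ⟨f₄, h₄⟩
    exact ⟨(f₁.mono (by simp) (by simp)).trans <| (f₂.mono (by simp) (by simp)).trans <|
      (f₃.mono (by simp) (by simp)).trans (f₄.mono (by simp) (by simp)), σ, hσ, hle, h₄⟩
  · simp [RealExpr.eval, IdxExpr.eval, scalar, f'.arr, f'.idx, f₃.arr, f₃.idx, f₂.arr, f₂.idx,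
      f₁.arr, f₁.idx, hk', h₃]

/-- Move until the first coordinate reaches `±1`. -/
def move : Prog :=
  .seq (mapLoop 3 1 12 .skip (.div
    (.sub (.sqrt (.mul (.cell 11 (.const 0) (.reg 3)) (.cell 11 (.const 0) (.reg 3))))
      (.mul (.cell 1 (.const 0) (.reg 3)) (.cell 11 (.const 0) (.reg 3))))
    (.mul (.cell 11 (.const 0) (.reg 3)) (.cell 11 (.const 0) (.reg 3))))) <|
  .seq (.setIdx 6 (.reg 5)) <|
  .seq (searchLoop 3 1 6 (.and
    (.realLt (.const 0) (.mul (.cell 11 (.const 0) (.reg 3)) (.cell 11 (.const 0) (.reg 3))))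
    (.realLt (.cell 12 (.const 0) (.reg 3)) (.cell 12 (.const 0) (.reg 6))))) <|
  mapLoop 3 1 1 .skip (.add (.cell 1 (.const 0) (.reg 3))
    (.mul (.cell 12 (.const 0) (.reg 6)) (.cell 11 (.const 0) (.reg 3))))

/-- A nonzero direction at the pivot makes the pivot an admissible initial candidate in the search
for the smallest step length. The expression `√(y * y)` serves as the absolute value. -/
theorem ends_move {n : ℕ} {s : State} (hn : s.idx 1 = n) (hq : s.idx 5 < n)
    (hyq : s.arr 11 0 (s.idx 5) ≠ 0) :
    Ends move s (n * 90 + 30) fun s' => Frame [3, 6] [1, 12] s s' ∧ ∃ g : ℕ → ℝ,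
      (∀ j < n, g j = (√(s.arr 11 0 j * s.arr 11 0 j) - s.arr 1 0 j * s.arr 11 0 j) /
        (s.arr 11 0 j * s.arr 11 0 j)) ∧
      s'.idx 6 < n ∧ s.arr 11 0 (s'.idx 6) ≠ 0 ∧
      (∀ j < n, s.arr 11 0 j ≠ 0 → g (s'.idx 6) ≤ g j) ∧
      ∀ j < n, s'.arr 1 0 j = s.arr 1 0 j + g (s'.idx 6) * s.arr 11 0 j := by
  set g : ℕ → ℝ := fun j => (√(s.arr 11 0 j * s.arr 11 0 j) - s.arr 1 0 j * s.arr 11 0 j) /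
        (s.arr 11 0 j * s.arr 11 0 j) with hg
  refine Ends.of_le ?_ (Ends.seq (Ends.mapLoop (N := n) (c := 1) (R := []) (L := []) g
      (by decide) (by decide) (by decide) hn
      fun k hk s' f' hk' _ => Ends.skip ⟨Frame.refl _ _ _, ?_⟩)
    fun s₁ ⟨f₁, h₁⟩ => Ends.seq (Q' := fun s' => Frame [6] [] s₁ s' ∧ s'.idx 6 = s.idx 5)
      (Ends.setIdx ⟨(Frame.refl _ _ _).writeIdx (by simp) _, ?_⟩)
    -- The minimum is found as a maximum of the negatives.
    fun s₂ ⟨f₂, h₂⟩ => Ends.seq (Ends.searchLoop (N := n) (fun j => -s₁.arr 12 0 j)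
      (fun j => s.arr 11 0 j ≠ 0) (by decide) (by decide) (by decide)
      (by rw [f₂.idx 1 (by simp), f₁.idx 1 (by simp), hn]) fun k hk s' f' hk' => ?_)
    fun s₃ ⟨f₃, h₃, h₃'⟩ => Ends.imp ?_ (Ends.mapLoop (N := n) (c := 1) (R := []) (L := [])
      (fun j => s.arr 1 0 j + s₁.arr 12 0 (s₃.idx 6) * s.arr 11 0 j)
      (by decide) (by decide) (by decide)
      (by rw [f₃.idx 1 (by simp), f₂.idx 1 (by simp), f₁.idx 1 (by simp), hn])
      fun k hk s' f' hk' hx => Ends.skip ⟨Frame.refl _ _ _, ?_⟩))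
  · simp only [IdxExpr.cost, Test.cost, RealExpr.cost]; omega
  · simp [RealExpr.eval, IdxExpr.eval, f'.arr, hk', hg]
  · simp [State.writeIdx_idx, IdxExpr.eval, f₁.idx]
  · simp only [Test.Holds, RealExpr.eval, IdxExpr.eval, f'.arr 11 (by simp), f₂.arr 11 (by simp),
      f₁.arr 11 (by simp), f'.arr 12 (by simp), f₂.arr 12 (by simp), hk', Int.cast_zero,
      neg_lt_neg_iff, mul_self_pos]
  · rintro s₄ ⟨f₄, h₄⟩
    have h6 : s₄.idx 6 = s₃.idx 6 := f₄.idx 6 (by simp)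
    have h7 : s₃.idx 6 < n ∧ s.arr 11 0 (s₃.idx 6) ≠ 0 := by
      rcases h₃ with h | h
      · rw [h, h₂]; exact ⟨hq, hyq⟩
      · exact h
    refine ⟨(f₁.mono (by simp) (by simp)).trans <| (f₂.mono (by simp) (by simp)).trans <|
      (f₃.mono (by simp) (by simp)).trans (f₄.mono (by simp) (by simp)), g, fun _ _ => rfl, ?_⟩
    rw [h6]
    refine ⟨h7.1, h7.2, fun j hj hyj => ?_, fun j hj => ?_⟩
    · rw [← h₁ _ h7.1, ← h₁ j hj]
      exact neg_le_neg_iff.1 (h₃' j hj hyj)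
    · rw [h₄ j hj, h₁ _ h7.1]
  · simp [RealExpr.eval, IdxExpr.eval, f'.arr, f'.idx, f₃.arr, f₂.arr, f₁.arr, hk', hx]

/-- Remove the index in register `6` from the support of `H`. -/
def removeIndex : Prog :=
  .seq (mapLoop 3 1 4 .skip (.cell 2 (.reg 3) (.reg 6))) <|
  .seq (setScalar 5 (.cell 2 (.reg 6) (.reg 6))) rankOneUpdate

/-- The column and the pivot are copied beforehand because the update overwrites them in `H`. -/
theorem ends_removeIndex {n : ℕ} {s : State} (hn : s.idx 1 = n) :
    Ends removeIndex s (n * (n * 26 + 40) + 30) fun s' => Frame [3, 4] [2, 4, 5] s s' ∧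
      ∀ i < n, ∀ j < n, s'.arr 2 i j = s.arr 2 i j -
        s.arr 2 i (s.idx 6) * s.arr 2 j (s.idx 6) / s.arr 2 (s.idx 6) (s.idx 6) := by
  refine Ends.of_le ?_ (Ends.seq (Ends.mapLoop (N := n) (c := 1) (R := []) (L := [])
      (fun j => s.arr 2 j (s.idx 6)) (by decide) (by decide) (by decide) hn
      fun k hk s' f' hk' _ => Ends.skip ⟨Frame.refl _ _ _, ?_⟩)
    fun s₁ ⟨f₁, h₁⟩ => Ends.seq (Q' := fun s' => Frame [] [5] s₁ s' ∧
      s'.arr 5 0 0 = s.arr 2 (s.idx 6) (s.idx 6))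
      (Ends.setScalar ⟨(Frame.refl _ _ _).writeCell (by simp) _ _ _, ?_⟩)
    fun s₂ ⟨f₂, h₂⟩ => Ends.imp ?_ (ends_rankOneUpdate (n := n)
      (by rw [f₂.idx 1 (by simp), f₁.idx 1 (by simp), hn])))
  · simp only [IdxExpr.cost, RealExpr.cost]; ring_nf; omega
  · simp [RealExpr.eval, IdxExpr.eval, f'.arr, f'.idx, hk']
  · simp [State.writeCell_arr, RealExpr.eval, IdxExpr.eval, f₁.arr, f₁.idx]
  · rintro s₃ ⟨f₃, h₃⟩
    refine ⟨(f₁.mono (by simp) (by simp)).trans <| (f₂.mono (by simp) (by simp)).trans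
      (f₃.mono (by simp) (by simp)), fun i hi j hj => ?_⟩
    rw [h₃ i hi j hj, h₂, f₂.arr 2 (by simp), f₁.arr 2 (by simp), f₂.arr 4 (by simp), h₁ i hi,
      h₁ j hj]

/-- One step of the walk. -/
def walkStep : Prog := .seq findPivot <| .seq findDirection <| .seq move removeIndex

theorem ends_walkStep {m n : ℕ} {s : State} {ε : ℝ} {S : Finset ℕ} (hm : s.idx 0 = m)
    (hn : s.idx 1 = n) (hε : 0 < ε) (hS : S.Nonempty)
    (hW : WalkInv m n (s.arr 0) ε S (s.arr 2) (s.arr 1 0)) :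
    Ends walkStep s (m * (n * 46 + 42) + n * (n * 26 + 190) + 138) fun s' =>
      Frame [3, 4, 5, 6] [1, 2, 4, 5, 6, 7, 8, 9, 10, 11, 12] s s' ∧
      ∃ p ∈ S, WalkInv m n (s.arr 0) ε (S.erase p) (s'.arr 2) (s'.arr 1 0) := by
  obtain ⟨i₀, hi₀⟩ := hS
  have hi₀n := hW.inv.lt hi₀
  refine Ends.of_le ?_ (Ends.seq (ends_findPivot hn (by omega)) fun s₁ ⟨f₁, hq, hmax⟩ =>
    Ends.seq (ends_findDirection (m := m) (n := n) (by rw [f₁.idx 0 (by simp), hm])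
      (by rw [f₁.idx 1 (by simp), hn])) fun s₂ ⟨f₂, σ, hσ, hle, hy⟩ =>
    Ends.seq (ends_move (n := n) (by rw [f₂.idx 1 (by simp), f₁.idx 1 (by simp), hn])
      (by rwa [f₂.idx 5 (by simp)]) ?_) fun s₃ ⟨f₃, g, hg, hp, hyp, hmin, hx⟩ =>
    Ends.imp ?_ (ends_removeIndex (n := n)
      (by rw [f₃.idx 1 (by simp), f₂.idx 1 (by simp), f₁.idx 1 (by simp), hn])))
  · ring_nf; omega
  · rw [f₂.idx 5 (by simp), hy _ hq, f₁.arr 2 (by simp)]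
    have := lt_of_lt_of_le (hW.inv.diag_pos hε hi₀) (hmax i₀ hi₀n)
    refine mul_ne_zero ?_ this.ne'
    rintro rfl
    norm_num at hσ
  · rintro s₄ ⟨f₄, hH⟩
    have hqpos := lt_of_lt_of_le (hW.inv.diag_pos hε hi₀) (hmax i₀ hi₀n)
    -- `H` vanishes off `S` and has positive diagonal on `S`, so the maximum over all columns lies
    -- in `S`; the program never stores `S`.
    have hqS : s₁.idx 5 ∈ S := by
      by_contra hc
      rw [hW.inv.off _ hq hc _ hq] at hqpos
      exact lt_irrefl _ hqpos
    simp only [f₁.arr _ List.not_mem_nil] at hle hy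
    rw [f₂.arr 1 (by simp), f₁.arr 1 (by simp)] at hg hx
    rw [f₃.arr 2 (by simp), f₂.arr 2 (by simp), f₁.arr 2 (by simp)] at hH
    refine ⟨(f₁.mono (by simp) (by simp)).trans <| (f₂.mono (by simp) (by simp)).trans <|
      (f₃.mono (by simp) (by simp)).trans (f₄.mono (by simp) (by simp)), s₃.idx 6, ?_, ?_⟩
    · by_contra hc
      rw [hy _ hp, hW.inv.off _ hp hc _ hq, mul_zero] at hyp
      exact hyp rfl
    · refine hW.step hε hqS (fun j hj => hmax j (hW.inv.lt hj)) hσ hle hy hg hp hyp hmin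
        (fun j hj => ?_) hH
      rw [f₄.arr 1 (by simp), hx j hj]

/-- Store in scalar `10` the inverse of the regularization parameter. -/
def initScale : Prog :=
  .seq (accLoop 2 0 6
    (sumLoop 3 1 7 (.mul (.cell 0 (.reg 2) (.reg 3)) (.cell 0 (.reg 2) (.reg 3)))) (scalar 7)) <|
  .seq (sumLoop 3 1 9 (.const 1)) <|
  .branch (.realLt (.const 0) (scalar 6))
    (setScalar 10 (.div (.mul (scalar 9) (scalar 9)) (scalar 6))) (setScalar 10 (.const 1))

/-- The real number `n` is obtained by adding up ones, as registers cannot be read as reals. The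
scalar is `n² / ‖A‖_F²`, or `1` for the zero matrix. -/
theorem ends_initScale {m n : ℕ} {s : State} (hm : s.idx 0 = m) (hn : s.idx 1 = n)
    (hpos : 1 ≤ n) :
    Ends initScale s (m * (n * 26 + 30) + n * 20 + 50) fun s' =>
      Frame [2, 3] [6, 7, 9, 10] s s' ∧ 0 < s'.arr 10 0 0 ∧
      (0 < ∑ t ∈ range m, ∑ j ∈ range n, s.arr 0 t j * s.arr 0 t j →
        (s'.arr 10 0 0)⁻¹ * n * n = ∑ t ∈ range m, ∑ j ∈ range n, s.arr 0 t j * s.arr 0 t j) := by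
  have hn0 : (0 : ℝ) < n := by exact_mod_cast hpos
  refine Ends.of_le ?_ (Ends.seq (Ends.accLoop (N := m) (c := n * 26 + 10) (R := [3]) (L := [7])
      (fun t => ∑ j ∈ range n, s.arr 0 t j * s.arr 0 t j) (by decide) (by decide) (by decide) hm
      fun t ht s' f' ht' => Ends.of_le ?_ (Ends.imp ?_
        (Ends.sumLoop (N := n) (fun j => s.arr 0 t j * s.arr 0 t j) (by decide)
          (by rw [f'.idx 1 (by simp), hn]) fun k hk s₁ f₁ hk₁ => ?_)))
    fun s₁ ⟨f₁, h₁⟩ => Ends.seq (Ends.sumLoop (N := n) (fun _ => 1) (by decide)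
      (by rw [f₁.idx 1 (by simp), hn]) fun k hk s₂ f₂ hk₂ => by simp [RealExpr.eval])
    fun s₂ ⟨f₂, h₂⟩ => Ends.branch (T := 14) (fun hb => Ends.of_le ?_ (Ends.setScalar
      ⟨((f₁.mono (by simp) (by simp)).trans (f₂.mono (by simp) (by simp))).writeCell
        (by simp) _ _ _, ?_⟩))
      fun hb => Ends.of_le ?_ (Ends.setScalar
      ⟨((f₁.mono (by simp) (by simp)).trans (f₂.mono (by simp) (by simp))).writeCell
        (by simp) _ _ _, ?_⟩))
  · simp only [IdxExpr.cost, Test.cost, RealExpr.cost, scalar]; ring_nf; omega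
  · simp only [IdxExpr.cost, RealExpr.cost]; omega
  · rintro s₁ ⟨f₁, h₁⟩
    exact ⟨f₁, by simpa [RealExpr.eval, IdxExpr.eval, scalar] using h₁⟩
  · simp [RealExpr.eval, IdxExpr.eval, f₁.arr, f₁.idx, f'.arr, hk₁, ht']
  · simp [IdxExpr.cost, RealExpr.cost, scalar]
  · simp only [Test.Holds, RealExpr.eval, IdxExpr.eval, scalar, f₂.arr 6 (by simp), h₁,
      Int.cast_zero] at hb
    simp only [State.writeCell_arr, RealExpr.eval, IdxExpr.eval, scalar, f₂.arr 6 (by simp), h₁, h₂,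
      and_self, if_true, sum_const, card_range, nsmul_eq_mul, mul_one]
    refine ⟨by positivity, fun _ => ?_⟩
    field_simp
  · simp [RealExpr.cost]
  · simp only [Test.Holds, RealExpr.eval, IdxExpr.eval, scalar, f₂.arr 6 (by simp), h₁,
      Int.cast_zero] at hb
    simp only [State.writeCell_arr, RealExpr.eval, and_self, if_true, Int.cast_one]
    exact ⟨one_pos, fun h => absurd h hb⟩

/-- Initialize `H` as a multiple of the identity. -/
def initDiagonal : Prog := forLoop 3 1 (.setCell 2 (.reg 3) (.reg 3) (scalar 10))

/-- Only the diagonal is written; the zeros elsewhere come from the initial memory. -/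
theorem ends_initDiagonal {n : ℕ} {s : State} (hn : s.idx 1 = n) (h0 : ∀ i j, s.arr 2 i j = 0) :
    Ends initDiagonal s (n * 14 + 6) fun s' => Frame [3] [2] s s' ∧
      ∀ i < n, ∀ j < n, s'.arr 2 i j = if i = j then s.arr 10 0 0 else 0 := by
  refine Ends.imp ?_ (Ends.forLoop (N := n) (c := 6) (fun k s' => Frame [3] [2] s s' ∧
    ∀ i j, s'.arr 2 i j = if i = j ∧ i < k then s.arr 10 0 0 else 0)
    (by decide) hn ⟨(Frame.refl _ _ _).writeIdx (by simp) _, by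
      simp [State.writeIdx_arr, h0]⟩ ?_)
  · rintro s' ⟨f, h⟩
    refine ⟨f, fun i hi j hj => ?_⟩
    rw [h]; simp [hi]
  · rintro k hk s₁ ⟨f₁, h₁⟩ hk₁ hn₁
    refine Ends.setCell ⟨hk₁, hn₁, (f₁.writeCell (by simp) _ _ _).writeIdx (by simp) _, ?_⟩
    intro i j
    simp only [State.writeIdx_arr, State.writeCell_arr, IdxExpr.eval, RealExpr.eval, scalar, hk₁,
      f₁.arr 10 (by simp), h₁, true_and]
    grind

/-- Update `H` for a further row of `A`. -/
def addRow : Prog :=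
  .seq (mapLoop 3 1 4 (sumLoop 4 1 7
    (.mul (.cell 2 (.reg 3) (.reg 4)) (.cell 0 (.reg 2) (.reg 4)))) (scalar 7)) <|
  .seq (sumLoop 3 1 9 (.mul (.cell 0 (.reg 2) (.reg 3)) (.cell 4 (.const 0) (.reg 3)))) <|
  .seq (setScalar 5 (.add (.const 1) (scalar 9))) rankOneUpdate

theorem ends_addRow {n r : ℕ} {s : State} {ε : ℝ} (hn : s.idx 1 = n) (hr : s.idx 2 = r)
    (hε : 0 ≤ ε) (h : IsInvOn n (range n) (regGram (s.arr 0) ε r) (s.arr 2)) :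
    Ends addRow s (n * (n * 60 + 80) + 50) fun s' => Frame [3, 4] [2, 4, 5, 7, 9] s s' ∧
      IsInvOn n (range n) (regGram (s.arr 0) ε (r + 1)) (s'.arr 2) := by
  refine Ends.of_le ?_ (Ends.seq (Ends.mapLoop (N := n) (c := n * 26 + 10) (R := [4]) (L := [7])
      (fun i => ∑ l ∈ range n, s.arr 2 i l * s.arr 0 r l) (by decide) (by decide) (by decide) hn
      fun i hi s' f' hi' _ => Ends.of_le ?_ (Ends.imp ?_
        (Ends.sumLoop (N := n) (fun l => s.arr 2 i l * s.arr 0 r l) (by decide)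
          (by rw [f'.idx 1 (by simp), hn]) fun k hk s₁ f₁ hk₁ => ?_)))
    fun s₁ ⟨f₁, h₁⟩ => Ends.seq (Ends.sumLoop (N := n) (fun j => s.arr 0 r j * s₁.arr 4 0 j)
      (by decide) (by rw [f₁.idx 1 (by simp), hn]) fun k hk s₂ f₂ hk₂ => ?_)
    fun s₂ ⟨f₂, h₂⟩ => Ends.seq (Q' := fun s' => Frame [] [5] s₂ s' ∧
      s'.arr 5 0 0 = 1 + ∑ j ∈ range n, s.arr 0 r j * s₁.arr 4 0 j)
      (Ends.setScalar ⟨(Frame.refl _ _ _).writeCell (by simp) _ _ _, ?_⟩)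
    fun s₃ ⟨f₃, h₃⟩ => Ends.imp ?_ (ends_rankOneUpdate (n := n)
      (by rw [f₃.idx 1 (by simp), f₂.idx 1 (by simp), f₁.idx 1 (by simp), hn])))
  · simp only [IdxExpr.cost, RealExpr.cost, scalar]; ring_nf; omega
  · simp only [IdxExpr.cost, RealExpr.cost]; omega
  · rintro s₁ ⟨f₁, h₁⟩
    exact ⟨f₁, by simpa [RealExpr.eval, IdxExpr.eval, scalar] using h₁⟩
  · simp [RealExpr.eval, IdxExpr.eval, f₁.arr, f₁.idx, f'.arr, f'.idx, hk₁, hi', hr]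
  · simp [RealExpr.eval, IdxExpr.eval, f₂.arr, f₂.idx, f₁.arr, f₁.idx, hk₂, hr]
  · simp [State.writeCell_arr, RealExpr.eval, IdxExpr.eval, scalar, h₂]
  · rintro s₄ ⟨f₄, h₄⟩
    refine ⟨(f₁.mono (by simp) (by simp)).trans <| (f₂.mono (by simp) (by simp)).trans <|
      (f₃.mono (by simp) (by simp)).trans (f₄.mono (by simp) (by simp)),
      h.add_row hε h₁ h₃ fun i hi j hj => ?_⟩
    rw [h₄ i hi j hj, f₃.arr 2 (by simp), f₂.arr 2 (by simp), f₁.arr 2 (by simp),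
      f₃.arr 4 (by simp), f₂.arr 4 (by simp)]

/-- Compute the inverse of the regularized Gram matrix. -/
def initInverse : Prog := .seq initScale <| .seq initDiagonal <| forLoop 2 0 addRow

theorem ends_initInverse {m n : ℕ} {s : State} (hm : s.idx 0 = m) (hn : s.idx 1 = n)
    (hpos : 1 ≤ n) (h0 : ∀ i j, s.arr 2 i j = 0) :
    Ends initInverse s (m * (n * (n * 60 + 106) + 88) + n * 34 + 62) fun s' =>
      Frame [2, 3, 4] [2, 4, 5, 6, 7, 9, 10] s s' ∧ ∃ ε : ℝ, 0 < ε ∧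
      (0 < ∑ t ∈ range m, ∑ j ∈ range n, s.arr 0 t j * s.arr 0 t j →
        ε * n * n = ∑ t ∈ range m, ∑ j ∈ range n, s.arr 0 t j * s.arr 0 t j) ∧
      IsInvOn n (range n) (regGram (s.arr 0) ε m) (s'.arr 2) := by
  refine Ends.of_le ?_ (Ends.seq (ends_initScale hm hn hpos) fun s₁ ⟨f₁, hD, hT⟩ =>
    Ends.seq (ends_initDiagonal (n := n) (by rw [f₁.idx 1 (by simp), hn])
      (by rw [f₁.arr 2 (by simp)]; exact h0)) fun s₂ ⟨f₂, h₂⟩ =>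
    Ends.imp ?_ (Ends.forLoop (N := m) (c := n * (n * 60 + 80) + 50) (fun k s' =>
      Frame [2, 3, 4] [2, 4, 5, 6, 7, 9, 10] s s' ∧
      IsInvOn n (range n) (regGram (s.arr 0) (s₁.arr 10 0 0)⁻¹ k) (s'.arr 2)) (by decide)
      (by rw [f₂.idx 0 (by simp), f₁.idx 0 (by simp), hm])
      ⟨((f₁.mono (by simp) (by simp)).trans (f₂.mono (by simp) (by simp))).writeIdx (by simp) _,
        IsInvOn.diagonal hD.ne' h₂⟩ ?_))
  · ring_nf; omega
  · rintro s₃ ⟨f₃, h₃⟩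
    exact ⟨f₃, _, inv_pos.2 hD, hT, h₃⟩
  · rintro k hk s₃ ⟨f₃, h₃⟩ hk₃ hm₃
    have hA := f₃.arr 0 (by simp)
    have := ends_addRow (n := n) (by rw [f₃.idx 1 (by simp), hn]) hk₃ (inv_pos.2 hD).le
      (hA.symm ▸ h₃)
    rw [hA] at this
    refine Ends.imp ?_ this
    rintro s₄ ⟨f₄, h₄⟩
    exact ⟨by rw [f₄.idx 2 (by simp), hk₃], by rw [f₄.idx 0 (by simp), hm₃],
      (f₃.trans (f₄.mono (by simp) (by simp))).writeIdx (by simp) _, h₄⟩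

/-- The coloring algorithm. -/
def colorProg : Prog := .seq initInverse (forLoop 2 1 walkStep)

theorem ends_colorProg {m n : ℕ} {s : State} (hm : s.idx 0 = m) (hn : s.idx 1 = n)
    (hpos : 1 ≤ n) (h0 : ∀ i j, s.arr 2 i j = 0) (hx : ∀ j, s.arr 1 0 j = 0) :
    Ends colorProg s (1000 * ((m + n) * n ^ 2)) fun s' => ∃ (ε : ℝ) (H : ℕ → ℕ → ℝ),
      (0 < ∑ t ∈ range m, ∑ j ∈ range n, s.arr 0 t j * s.arr 0 t j →
        ε * n * n = ∑ t ∈ range m, ∑ j ∈ range n, s.arr 0 t j * s.arr 0 t j) ∧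
      WalkInv m n (s.arr 0) ε ∅ H (s'.arr 1 0) := by
  refine Ends.of_le ?_ (Ends.seq (ends_initInverse hm hn hpos h0) fun s₁ ⟨f₁, ε, hε, hT, h₁⟩ =>
    Ends.imp ?_ (Ends.forLoop (N := n) (c := m * (n * 46 + 42) + n * (n * 26 + 190) + 138)
      -- Exactly one index leaves `S` per round, even if several coordinates reach `±1` at once, so
      -- `n` rounds empty it.
      (fun k s' => s'.idx 0 = m ∧ s'.arr 0 = s.arr 0 ∧ ∃ S : Finset ℕ, S.card = n - k ∧
        WalkInv m n (s.arr 0) ε S (s'.arr 2) (s'.arr 1 0)) (by decide)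
      (by rw [f₁.idx 1 (by simp), hn]) ⟨?_, f₁.arr 0 (by simp), range n, by simp,
        WalkInv.init h₁ fun j hj => ?_⟩ ?_))
  · have h1 : m ≤ m * n := Nat.le_mul_of_pos_right m hpos
    have h2 : m * n ≤ m * n ^ 2 := by rw [sq, ← mul_assoc]; exact Nat.le_mul_of_pos_right _ hpos
    have h3 : n ≤ n ^ 2 := by rw [sq]; exact Nat.le_mul_of_pos_right _ hpos
    have h4 : n ^ 2 ≤ n ^ 3 := Nat.pow_le_pow_right hpos (by norm_num)
    ring_nf at h1 h2 h3 h4 ⊢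
    omega
  · rintro s₂ ⟨-, -, S, hS, hW⟩
    rw [Nat.sub_self, card_eq_zero] at hS
    subst hS
    exact ⟨ε, _, hT, hW⟩
  · rw [State.writeIdx_idx, if_neg (by decide), f₁.idx 0 (by simp), hm]
  · rw [State.writeIdx_arr, f₁.arr 1 (by simp), hx]
  · rintro k hk s₂ ⟨hm₂, hA₂, S, hS, hW⟩ hk₂ hn₂
    have := ends_walkStep hm₂ hn₂ hε (card_pos.1 (by omega)) (hA₂.symm ▸ hW)
    refine Ends.imp ?_ this
    rintro s₃ ⟨f₃, p, hp, hW₃⟩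
    refine ⟨by rw [f₃.idx 2 (by simp), hk₂], by rw [f₃.idx 1 (by simp), hn₂], ?_, ?_,
      S.erase p, ?_, hA₂ ▸ hW₃⟩
    · rw [State.writeIdx_idx, if_neg (by decide), f₃.idx 0 (by simp), hm₂]
    · rw [State.writeIdx_arr, f₃.arr 0 (by simp), hA₂]
    · rw [card_erase_of_mem hp, hS]; omega

end RealRAM

/-! ### Hereditary discrepancy -/

theorem finite_colorings (ι : Type) [Finite ι] : (colorings ι).Finite := by
  have h : colorings ι = {x | ∀ i, x i ∈ ({-1, 1} : Set ℝ)} := by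
    ext x; simp [colorings]
  rw [h]
  exact Set.Finite.pi' fun _ => Set.toFinite _

theorem discTwoOf_nonneg {m : ℕ} {ι : Type} [Fintype ι] (A : Matrix (Fin m) ι ℝ) (x : ι → ℝ) :
    0 ≤ discTwoOf A x := div_nonneg (norm_nonneg _) (Real.sqrt_nonneg _)

theorem discTwoOf_sq {m : ℕ} (hm : 1 ≤ m) {ι : Type} [Fintype ι] (A : Matrix (Fin m) ι ℝ)
    (x : ι → ℝ) : m * discTwoOf A x ^ 2 = ∑ t, (∑ j, A t j * x j) ^ 2 := by
  have hm0 : (0 : ℝ) < m := by exact_mod_cast hm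
  rw [discTwoOf, div_pow, Real.sq_sqrt hm0.le, mul_div_cancel₀ _ hm0.ne',
    EuclideanSpace.norm_sq_eq]
  simp [Matrix.mulVec, dotProduct]

theorem exists_coloring_discTwoOf_eq {m : ℕ} {ι : Type} [Fintype ι] (A : Matrix (Fin m) ι ℝ) :
    ∃ x ∈ colorings ι, discTwoOf A x = discTwo A := by
  have : Finite (colorings ι) := finite_colorings ι
  have : Nonempty (colorings ι) := ⟨⟨fun _ => 1, fun _ => Or.inr rfl⟩⟩
  obtain ⟨x, hx⟩ := exists_eq_ciInf_of_finite (f := fun x : colorings ι => discTwoOf A x.1)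
  exact ⟨x.1, x.2, hx⟩

theorem discTwo_le_herdiscTwo {m n : ℕ} (A : Matrix (Fin m) (Fin n) ℝ) (J : Finset (Fin n)) :
    discTwo (A.submatrix id (fun j : J => (j : Fin n))) ≤ herdiscTwo A :=
  le_ciSup (f := fun J : Finset (Fin n) => discTwo (A.submatrix id (fun j : J => (j : Fin n))))
    (Set.finite_range _).bddAbove J

theorem herdiscTwo_nonneg {m n : ℕ} (A : Matrix (Fin m) (Fin n) ℝ) : 0 ≤ herdiscTwo A := by
  obtain ⟨x, -, hx⟩ := exists_coloring_discTwoOf_eq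
    (A.submatrix id (fun j : (∅ : Finset (Fin n)) => (j : Fin n)))
  exact (discTwoOf_nonneg _ x).trans (hx.le.trans (discTwo_le_herdiscTwo A ∅))

/-! ### From the machine's input to the final estimate -/

theorem input_arr_zero {m n : ℕ} (A : Matrix (Fin m) (Fin n) ℝ) (t : Fin m) (j : Fin n) :
    (RealRAM.input A).arr 0 t j = A t j := by
  simp [RealRAM.input]

theorem herBound_input {m n : ℕ} (hm : 1 ≤ m) (A : Matrix (Fin m) (Fin n) ℝ) :
    HerBound m n ((RealRAM.input A).arr 0) (m * herdiscTwo A ^ 2) := by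
  intro J hJ
  have hJn : ∀ j ∈ J, j < n := fun j hj => mem_range.1 (hJ hj)
  obtain ⟨x, hx, hxe⟩ := exists_coloring_discTwoOf_eq
    (A.submatrix id (fun j : J.attachFin hJn => (j : Fin n)))
  let χ : ℕ → ℝ := fun j => if h : j ∈ J then x ⟨⟨j, hJn j h⟩, by simpa using h⟩ else 1
  refine ⟨χ, fun j => ?_, ?_⟩
  · simp only [χ]
    split_ifs
    · exact hx _
    · exact Or.inr rfl
  have hsq := discTwoOf_sq hm (A.submatrix id (fun j : J.attachFin hJn => (j : Fin n))) x
  have hle : discTwoOf (A.submatrix id (fun j : J.attachFin hJn => (j : Fin n))) x ≤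
      herdiscTwo A := hxe.le.trans (discTwo_le_herdiscTwo A _)
  have h0 := discTwoOf_nonneg (A.submatrix id (fun j : J.attachFin hJn => (j : Fin n))) x
  calc _ = ∑ t : Fin m, (∑ j : J.attachFin hJn,
        (A.submatrix id (fun j : J.attachFin hJn => (j : Fin n))) t j * x j) ^ 2 := by
        rw [sum_range]
        refine sum_congr rfl fun t _ => ?_
        congr 1
        conv_lhs => rw [← map_valEmbedding_attachFin hJn, sum_map]
        rw [← sum_coe_sort]
        refine sum_congr rfl fun j _ => ?_
        have hj : ((j : Fin n) : ℕ) ∈ J := (mem_attachFin hJn).1 j.2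
        simp [χ, hj, input_arr_zero]
    _ = _ := hsq.symm
    _ ≤ m * herdiscTwo A ^ 2 := by gcongr

/-- The harmonic sum is at most `1 + log n`, and for `n ≥ 2` both terms are at most `logb 2 n`. -/
theorem sum_Ioc_inv_le {n : ℕ} (hn : 2 ≤ n) :
    ∑ k ∈ Ioc 0 n, ((k : ℝ))⁻¹ ≤ 2 * Real.logb 2 n := by
  have h1 := harmonic_le_one_add_log n
  rw [harmonic_eq_sum_Icc] at h1
  push_cast at h1
  have e : Ioc 0 n = Icc 1 n := rfl
  rw [e]
  have hn' : (2 : ℝ) ≤ n := by exact_mod_cast hn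
  have h2 : 1 ≤ Real.logb 2 n := by
    rw [Real.le_logb_iff_rpow_le (by norm_num) (by linarith)]
    simpa using hn'
  have h3 : Real.log n = Real.logb 2 n * Real.log 2 := by
    rw [Real.logb, div_mul_cancel₀]
    exact (Real.log_pos (by norm_num)).ne'
  have h4 : Real.log 2 ≤ 1 := by linarith [Real.log_two_lt_d9]
  nlinarith

theorem energy_input {m n : ℕ} (hm : 1 ≤ m) (A : Matrix (Fin m) (Fin n) ℝ) (x : ℕ → ℝ) :
    energy m n ((RealRAM.input A).arr 0) x = m * discTwoOf A (fun j : Fin n => x j) ^ 2 := by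
  rw [discTwoOf_sq hm, energy, sum_range]
  refine sum_congr rfl fun t _ => ?_
  rw [sum_range]
  simp only [input_arr_zero]

theorem energy_le_of_walkInv {m n : ℕ} (hn : 2 ≤ n) {A H : ℕ → ℕ → ℝ} {ε V : ℝ} {x : ℕ → ℝ}
    (hV : HerBound m n A V) (h : WalkInv m n A ε ∅ H x)
    (hT : 0 < ∑ t ∈ range m, ∑ j ∈ range n, A t j * A t j →
        ε * n * n = ∑ t ∈ range m, ∑ j ∈ range n, A t j * A t j) :
    energy m n A x ≤ 256 * V * Real.logb 2 n := by
  have hn0 : (0 : ℝ) < n := by exact_mod_cast (by omega : 0 < n)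
  have hV0 := hV.nonneg
  have hlog : 0 ≤ Real.logb 2 (n : ℝ) :=
    Real.logb_nonneg (by norm_num) (by exact_mod_cast (by omega : 1 ≤ n))
  have hnn : 0 ≤ ∑ t ∈ range m, ∑ j ∈ range n, A t j * A t j :=
    sum_nonneg fun t _ => sum_nonneg fun j _ => mul_self_nonneg _
  rcases hnn.lt_or_eq with hpos | hzero
  · have hεV : ε * n ≤ V := by
      have h1 := hV.sum_sq_le
      rw [← hT hpos, mul_comm (n : ℝ) V] at h1
      exact le_of_mul_le_mul_right h1 hn0
    have h2 := h.final hV hεV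
    simp only [div_eq_mul_inv, ← mul_sum] at h2
    have h3 := mul_le_mul_of_nonneg_left (sum_Ioc_inv_le hn) (show 0 ≤ 128 * V by positivity)
    linarith
  -- For the zero matrix `ε n ≤ V` may fail, but the energy vanishes.
  · have h1 : ∀ t ∈ range m, ∀ j ∈ range n, A t j = 0 := by
      intro t ht j hj
      have h2 := (sum_eq_zero_iff_of_nonneg fun t _ => sum_nonneg fun j _ =>
        mul_self_nonneg (A t j)).1 hzero.symm t ht
      exact mul_self_eq_zero.1
        ((sum_eq_zero_iff_of_nonneg fun j _ => mul_self_nonneg (A t j)).1 h2 j hj)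
    have h2 : energy m n A x = 0 := by
      refine sum_eq_zero fun t ht => ?_
      rw [sum_eq_zero fun j hj => by rw [h1 t ht j hj, zero_mul]]
      simp
    rw [h2]
    positivity

theorem mainTheorem1 :
    ∃ (P : RealRAM.Prog) (c : ℕ) (K : ℝ),
      ∀ (m n : ℕ), 1 ≤ m → 1 ≤ n → ∀ A : Matrix (Fin m) (Fin n) ℝ,
        ∃ (t : ℕ) (s : RealRAM.State),
          RealRAM.Run P (RealRAM.input A) t s ∧
          t ≤ c * ((m + n) * n ^ 2) ∧
          RealRAM.output n s ∈ colorings (Fin n) ∧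
          (2 ≤ n →
            discTwoOf A (RealRAM.output n s) ≤
              K * √(Real.logb 2 (n : ℝ)) * herdiscTwo A) := by
  -- `16` is the square root of the factor `256` in `energy_le_of_walkInv`, applied with `V = m *
  -- herdiscTwo A ^ 2`.
  refine ⟨RealRAM.colorProg, 1000, 16, fun m n hm hn A => ?_⟩
  obtain ⟨t, s, hrun, ht, ε, H, hT, hW⟩ := RealRAM.ends_colorProg (s := RealRAM.input A)
    (m := m) (n := n) (by simp [RealRAM.input]) (by simp [RealRAM.input]) hn
    (by simp [RealRAM.input]) (by simp [RealRAM.input])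
  refine ⟨t, s, hrun, ht, fun j => hW.fixed j j.2 (by simp), fun hn2 => ?_⟩
  have h1 := energy_le_of_walkInv hn2 (herBound_input hm A) hW hT
  rw [energy_input hm] at h1
  have hm0 : (0 : ℝ) < m := by exact_mod_cast hm
  have hlog : 0 ≤ Real.logb 2 (n : ℝ) :=
    Real.logb_nonneg (by norm_num) (by exact_mod_cast hn)
  have hh := herdiscTwo_nonneg A
  refine le_of_sq_le_sq ?_ (by positivity)
  rw [mul_pow, mul_pow, Real.sq_sqrt hlog]
  refine le_of_mul_le_mul_left (h1.trans (le_of_eq ?_)) hm0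
  ring
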